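/- **Lemma.** Let $n\ge 1$ and $\frac1n<\alpha\le 1$, and let $m>0$, $M$ and $H$ be real numbers. There is a constant $C>0$, depending only on $n,\alpha,m,M,H$, with the following property. Let $\tilde S:\mathbb S^n\times[0,\infty)\to\mathbb R$ be of class $C^4$ (jointly in $(z,\tau)$, up to $\tau=0$), let the matrix $(\bar\nabla_i\bar\nabla_j\tilde S+\tilde S\,\delta_{ij})$ be positive definite at every $(z,\tau)$, and suppose that $$\Big(\tfrac1{n+1}\tilde S-\tilde S_\tau\Big)\big[\det(\bar\nabla_i\bar\nabla_j\tilde S+\tilde S\,\delta_{ij})\big]^\alpha=\frac1{\tilde\eta(\tau)}\quad\text{on }\mathbb S^n\times[0,\infty),\qquad \tilde\eta(\tau)=\int_{\mathbb S^n}\frac{1}{\tilde K^{1-\alpha}}\,d\sigma_{\mathbb S^n},\quad \tilde K=\frac1{\det(\bar\nabla_i\bar\nabla_j\tilde S+\tilde S\,\delta_{ij})}.$$ Here $\bar\nabla$ is the Levi-Civita connection of the round metric on the unit sphere $\mathbb S^n\subset\mathbb R^{n+1}$, indices refer to an orthonormal frame, $|\cdot|$ is the norm induced by the round metric, and $\sigma_{\mathbb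 S^n}$ is the surface measure. Assume $|\bar\nabla^2\tilde S(\cdot,0)|\le H$ on $\mathbb S^n$. If $0<T\le\infty$ and $m\le\tilde S\le M$ on $\mathbb S^n\times[0,T)$, then $$|\bar\nabla^2\tilde S|\le C\quad\text{on }\mathbb S^n\times[0,T).$$ In particular, for $T=\infty$, the Hessian is bounded by $C$ on $\mathbb S^n\times[0,\infty)$. -/

import Mathlib

open scoped Manifold

noncomputable section

namespace GaussFlow

/-- The ambient Euclidean space `ℝ^{n+1}`. -/
abbrev Ambient (n : ℕ) : Type := EuclideanSpace ℝ (Fin (n + 1))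

/-- The unit sphere `𝕊^n` in `ℝ^{n+1}`. -/
abbrev USphere (n : ℕ) : Type := Metric.sphere (0 : Ambient n) 1

/-- The extension of a function on `𝕊^n` to `ℝ^{n+1}` that is positively homogeneous of degree
`0`, that is, `x ↦ f (x / |x|)` for `x ≠ 0` (the value at the origin plays no role). -/
def radialExt {n : ℕ} (f : USphere n → ℝ) (x : Ambient n) : ℝ :=
  if hx : x = 0 then 0 else f ⟨‖x‖⁻¹ • x, by
    rw [mem_sphere_zero_iff_norm, norm_smul, norm_inv, norm_norm,
      inv_mul_cancel₀ (norm_ne_zero_iff.mpr hx)]⟩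

/-- The covariant Hessian `∇̄²f` of `f` on the round sphere, at `z`, on tangent vectors
`u, v ⊥ z`. In general it is the tangential part of the Euclidean Hessian of an extension `F` of
`f`, minus `⟪u, v⟫` times the radial derivative of `F` at `z`; for the extension that is
homogeneous of degree `0` the radial derivative vanishes. -/
def sphHess {n : ℕ} (f : USphere n → ℝ) (z : USphere n) (u v : Ambient n) : ℝ :=
  fderiv ℝ (fderiv ℝ (radialExt f)) (z : Ambient n) u v

/-- An orthonormal frame `e_1, …, e_n` of the tangent space `T_z 𝕊^n = z^⊥`. The quantities
defined with it below do not depend on the choice of the frame. -/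
def frame {n : ℕ} (z : USphere n) (i : Fin n) : Ambient n :=
  haveI : Fact (Module.finrank ℝ (Ambient n) = n + 1) := ⟨finrank_euclideanSpace_fin⟩
  ((OrthonormalBasis.fromOrthogonalSpanSingleton (𝕜 := ℝ) n
    (ne_zero_of_mem_unit_sphere z) i : (Submodule.span ℝ {(z : Ambient n)})ᗮ) : Ambient n)

/-- The matrix `(∇̄_i ∇̄_j f)` at `z` in an orthonormal frame. -/
def hessMatrix {n : ℕ} (f : USphere n → ℝ) (z : USphere n) : Matrix (Fin n) (Fin n) ℝ :=
  Matrix.of fun i j => sphHess f z (frame z i) (frame z j)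

/-- The norm `|∇̄² f|` at `z`, induced by the round metric. -/
def hessNorm {n : ℕ} (f : USphere n → ℝ) (z : USphere n) : ℝ :=
  Real.sqrt (∑ i, ∑ j, (hessMatrix f z i j) ^ 2)

/-- The matrix `∇̄_i ∇̄_j f + f δ_ij` at `z` in an orthonormal frame. If `f` is a support function,
this is the second fundamental form in the parametrization by the normal. -/
def radiiMatrix {n : ℕ} (f : USphere n → ℝ) (z : USphere n) : Matrix (Fin n) (Fin n) ℝ :=
  hessMatrix f z + f z • (1 : Matrix (Fin n) (Fin n) ℝ)

/-- The Gauss curvature, at the point with outward normal `z`, of the strictly convex hypersurface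
with support function `f`. -/
def gaussCurv {n : ℕ} (f : USphere n → ℝ) (z : USphere n) : ℝ :=
  ((radiiMatrix f z).det)⁻¹

/-- The quantity `η = ∫_{𝕊^n} K^{-(1-α)} dσ`, with `σ` the surface measure of `𝕊^n`. -/
def eta {n : ℕ} (α : ℝ) (f : USphere n → ℝ) : ℝ :=
  ∫ z, 1 / (gaussCurv f z) ^ (1 - α)
    ∂((MeasureTheory.volume : MeasureTheory.Measure (Ambient n)).toSphere)

/-- `S` is a `C^4` strictly convex solution on `𝕊^n × [0, ∞)` of
`(S / (n+1) - S_τ) (det (∇̄_i ∇̄_j S + S δ_ij))^α = 1 / η`. -/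
structure IsNormalizedSolution {n : ℕ} (α : ℝ) (S : USphere n → ℝ → ℝ) : Prop where
  /-- `S` is of class `C^4` in space and time, up to the initial time. -/
  contMDiffOn : ContMDiffOn ((𝓡 n).prod 𝓘(ℝ, ℝ)) 𝓘(ℝ, ℝ) 4
    (fun p : USphere n × ℝ => S p.1 p.2) (Set.univ ×ˢ Set.Ici (0 : ℝ))
  /-- Strict convexity of the hypersurfaces with support functions `S (·, τ)`. -/
  posDef : ∀ (z : USphere n) (τ : ℝ), 0 ≤ τ → (radiiMatrix (fun y => S y τ) z).PosDef
  /-- The evolution equation. -/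
  equation : ∀ (z : USphere n) (τ : ℝ), 0 ≤ τ →
    (1 / ((n : ℝ) + 1) * S z τ - derivWithin (S z) (Set.Ici 0) τ) *
      ((radiiMatrix (fun y => S y τ) z).det) ^ α = 1 / eta α (fun y => S y τ)

end GaussFlow

end

noncomputable section

namespace GaussFlow

open Set Topology Matrix

/-! The proof is a Pogorelov-type maximum principle. Let `u = ext₁ S` be the extension of the
support function that is homogeneous of degree one. Its Hessian kills the radial direction and
equals `∇̄²S + S g` on tangent vectors, so the principal radii are values `u_aa` on unit tangent
vectors `a`. The test function is `log u_aa - A log u + |Du|²/2` with `A = 2 + M²`. Its maximum over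
all unit tangent vectors and all times up to a given one is attained, and there `a` may be taken to
be an eigenvector `e_o` for the largest radius.

Near a maximum point `z₀` everything is read on the tangent plane `z₀ + z₀^⊥` (gnomonic projection).
There the determinant differs from that of the radii matrix only by a power of `|x|`
(`det_hessExt`), and on lines through `z₀` the equation becomes `u_t = u/(n+1) - (1/η) (1+s²)^γ (det
D²u)^(-α)` with `2γ = 1 - α(n+2)` (`D_time_line`). Ordinary partial derivatives commute, so no
curvature commutators appear; the geometry of the sphere survives only in explicit functions of `s`.

At a maximum with positive time, the time derivative is nonnegative and the second derivatives along
the lines are nonpositive. Weighting the latter by inverse radii and combining (`lt_radiusBound`)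
gives `0 ≤ (1 - A + |Du|²)/(n+1) + ρ Y`, where `ρ ≥ 0` is `1/η` times the speed factor. Since `|Du|
≤ M` (`gradSq_le`), the first term is negative, and `Y ≤ 0` once the largest radius is large: the
squared gradient contributes `-α ∑ λ_k` to `Y`. Only the sign of `η` matters, so no estimate of it
is needed. The initial time is covered by `H`. Comparing test function values bounds all radii,
hence the Hessian. -/

/-! ### Directional derivatives up to the initial time -/

/-- Nonzero points of the ambient space, at nonnegative times. -/
def Dom (n : ℕ) : Set (Ambient n × ℝ) := {0}ᶜ ×ˢ Ici 0

/-- The derivative along `Dom n` in the direction `w`. -/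
def D {n : ℕ} (w : Ambient n × ℝ) (f : Ambient n × ℝ → ℝ) (p : Ambient n × ℝ) : ℝ :=
  fderivWithin ℝ f (Dom n) p w

/-- The derivative along `Dom n` in the spatial direction `a`. -/
abbrev Dx {n : ℕ} (a : Ambient n) (f : Ambient n × ℝ → ℝ) : Ambient n × ℝ → ℝ := D (a, 0) f

lemma mem_Dom {n : ℕ} {x : Ambient n} {t : ℝ} : (x, t) ∈ Dom n ↔ x ≠ 0 ∧ 0 ≤ t := by
  simp [Dom]

lemma uniqueDiffOn_Dom (n : ℕ) : UniqueDiffOn ℝ (Dom n) :=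
  isOpen_compl_singleton.uniqueDiffOn.prod (uniqueDiffOn_Ici 0)

/-- Second derivatives along a set are symmetric at points of the closure of its interior; this
admits points at time zero. -/
lemma Dom_subset_closure_interior (n : ℕ) : Dom n ⊆ closure (interior (Dom n)) := by
  rw [Dom, interior_prod_eq, closure_prod_eq, interior_Ici, closure_Ioi,
    isOpen_compl_singleton.interior_eq]
  exact prod_mono subset_closure subset_rfl

lemma contDiffOn_D {n : ℕ} {k l : ℕ} {f : Ambient n × ℝ → ℝ} (hf : ContDiffOn ℝ k f (Dom n))
    (hl : l + 1 ≤ k) (w : Ambient n × ℝ) : ContDiffOn ℝ l (D w f) (Dom n) :=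
  (hf.fderivWithin (uniqueDiffOn_Dom n) (by exact_mod_cast hl)).clm_apply contDiffOn_const

lemma D_add {n : ℕ} (f : Ambient n × ℝ → ℝ) (p w w' : Ambient n × ℝ) :
    D (w + w') f p = D w f p + D w' f p := by simp [D]

lemma Dx_add {n : ℕ} (f : Ambient n × ℝ → ℝ) (p : Ambient n × ℝ) (a b : Ambient n) :
    Dx (a + b) f p = Dx a f p + Dx b f p := by rw [← D_add]; simp

lemma Dx_smul {n : ℕ} (f : Ambient n × ℝ → ℝ) (p : Ambient n × ℝ) (c : ℝ) (a : Ambient n) :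
    Dx (c • a) f p = c * Dx a f p := by
  have : ((c • a, 0) : Ambient n × ℝ) = c • (a, 0) := by simp
  rw [Dx, Dx, D, D, this, map_smul, smul_eq_mul]

lemma Dx_sum {n : ℕ} {ι : Type*} (s : Finset ι) (f : Ambient n × ℝ → ℝ) (p : Ambient n × ℝ)
    (a : ι → Ambient n) : Dx (∑ i ∈ s, a i) f p = ∑ i ∈ s, Dx (a i) f p := by
  have : ((∑ i ∈ s, a i, 0) : Ambient n × ℝ) = ∑ i ∈ s, ((a i, 0) : Ambient n × ℝ) := by
    ext <;> simp [Prod.fst_sum, Prod.snd_sum]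
  simp only [Dx, D, this, map_sum]

lemma D_congr {n : ℕ} {f g : Ambient n × ℝ → ℝ} (h : EqOn f g (Dom n)) {p : Ambient n × ℝ}
    (hp : p ∈ Dom n) (w : Ambient n × ℝ) : D w f p = D w g p := by
  rw [D, D, fderivWithin_congr h (h hp)]

lemma D_D_eq {n : ℕ} {f : Ambient n × ℝ → ℝ} (hf : ContDiffOn ℝ 2 f (Dom n))
    {p : Ambient n × ℝ} (hp : p ∈ Dom n) (w w' : Ambient n × ℝ) :
    D w (D w' f) p = fderivWithin ℝ (fderivWithin ℝ f (Dom n)) (Dom n) p w w' := by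
  have h1 : DifferentiableWithinAt ℝ (fderivWithin ℝ f (Dom n)) (Dom n) p :=
    (hf.fderivWithin (m := 1) (uniqueDiffOn_Dom n) (by norm_num)).differentiableOn
      (by norm_num) p hp
  have h2 := h1.hasFDerivWithinAt.clm_apply (hasFDerivWithinAt_const w' p (Dom n))
  have h3 := h2.fderivWithin (uniqueDiffOn_Dom n p hp)
  change fderivWithin ℝ (fun q => fderivWithin ℝ f (Dom n) q w') (Dom n) p w = _
  rw [h3]
  simp

lemma D_comm {n : ℕ} {f : Ambient n × ℝ → ℝ} (hf : ContDiffOn ℝ 2 f (Dom n))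
    {p : Ambient n × ℝ} (hp : p ∈ Dom n) (w w' : Ambient n × ℝ) :
    D w (D w' f) p = D w' (D w f) p := by
  rw [D_D_eq hf hp, D_D_eq hf hp]
  exact (hf p hp).isSymmSndFDerivWithinAt (by simp) (uniqueDiffOn_Dom n)
    (Dom_subset_closure_interior n hp) hp w w'

lemma Dx_comm {n : ℕ} {f : Ambient n × ℝ → ℝ} (hf : ContDiffOn ℝ 2 f (Dom n))
    {p : Ambient n × ℝ} (hp : p ∈ Dom n) (a b : Ambient n) :
    Dx a (Dx b f) p = Dx b (Dx a f) p := D_comm hf hp _ _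

/-- A function differentiable along `Dom n` is differentiable on spatial lines. -/
lemma hasDerivAt_line {n : ℕ} {f : Ambient n × ℝ → ℝ} (hf : DifferentiableOn ℝ f (Dom n))
    (x a : Ambient n) {t s : ℝ} (hx : x + s • a ≠ 0) (ht : 0 ≤ t) :
    HasDerivAt (fun s => f (x + s • a, t)) (Dx a f (x + s • a, t)) s := by
  have h1 := (hf _ (mem_Dom.2 ⟨hx, ht⟩)).hasFDerivWithinAt
  have h2 : HasDerivAt (fun s : ℝ => ((x + s • a, t) : Ambient n × ℝ)) (a, 0) s := by
    refine HasDerivAt.prodMk ?_ (hasDerivAt_const _ _)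
    simpa using ((hasDerivAt_id s).smul_const a).const_add x
  have hopen : IsOpen ((fun s : ℝ => x + s • a) ⁻¹' {0}ᶜ) :=
    isOpen_compl_singleton.preimage (by fun_prop)
  have h3 := h1.comp_hasDerivWithinAt s (s := (fun s : ℝ => x + s • a) ⁻¹' {0}ᶜ)
    h2.hasDerivWithinAt (fun y hy => mem_Dom.2 ⟨hy, ht⟩)
  exact h3.hasDerivAt (hopen.mem_nhds hx)

/-- A function differentiable along `Dom n` is differentiable in time, up to the initial time. -/
lemma hasDerivWithinAt_time {n : ℕ} {f : Ambient n × ℝ → ℝ} (hf : DifferentiableOn ℝ f (Dom n))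
    {x : Ambient n} {t : ℝ} (hx : x ≠ 0) (ht : 0 ≤ t) :
    HasDerivWithinAt (fun t => f (x, t)) (D (0, 1) f (x, t)) (Ici 0) t := by
  have h1 := (hf _ (mem_Dom.2 ⟨hx, ht⟩)).hasFDerivWithinAt
  have h2 : HasDerivAt (fun s : ℝ => ((x, s) : Ambient n × ℝ)) (0, 1) t :=
    HasDerivAt.prodMk (hasDerivAt_const _ _) (hasDerivAt_id t)
  exact h1.comp_hasDerivWithinAt t h2.hasDerivWithinAt (fun y hy => mem_Dom.2 ⟨hx, hy⟩)

lemma hasDerivAt_time {n : ℕ} {f : Ambient n × ℝ → ℝ} (hf : DifferentiableOn ℝ f (Dom n))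
    {x : Ambient n} {t : ℝ} (hx : x ≠ 0) (ht : 0 < t) :
    HasDerivAt (fun t => f (x, t)) (D (0, 1) f (x, t)) t :=
  (hasDerivWithinAt_time hf hx ht.le).hasDerivAt (Ici_mem_nhds ht)

/-! ### Homogeneous functions -/

/-- `f` is positively homogeneous of degree `k` in space. -/
def Homog {n : ℕ} (k : ℤ) (f : Ambient n × ℝ → ℝ) : Prop :=
  ∀ (c : ℝ) (x : Ambient n) (t : ℝ), 0 < c → x ≠ 0 → 0 ≤ t → f (c • x, t) = c ^ k * f (x, t)

/-- Spatial derivatives lower the degree of homogeneity by one. -/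
lemma Homog.dx {n : ℕ} {k : ℤ} {f : Ambient n × ℝ → ℝ} (h : Homog k f)
    (hf : DifferentiableOn ℝ f (Dom n)) (a : Ambient n) : Homog (k - 1) (Dx a f) := by
  intro c x t hc hx ht
  have h1 := hasDerivAt_line hf (c • x) (c • a) (t := t) (s := 0) (by simp [hc.ne', hx]) ht
  have h2 := (hasDerivAt_line hf x a (t := t) (s := 0) (by simp [hx]) ht).const_mul (c ^ k)
  have hU : ∀ᶠ s : ℝ in 𝓝 0, x + s • a ≠ 0 := by
    refine ContinuousAt.eventually_ne (by fun_prop) (by simpa using hx)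
  have h3 := h1.congr_of_eventuallyEq (f₁ := fun s => c ^ k * f (x + s • a, t)) (by
    filter_upwards [hU] with s hs
    rw [← h c _ t hc hs ht]
    congr 2
    rw [smul_add, smul_comm])
  have h4 := h3.unique h2
  rw [Dx_smul] at h4
  simp only [zero_smul, add_zero] at h4
  rw [zpow_sub_one₀ hc.ne']
  field_simp
  linarith

/-- Euler's identity. -/
lemma Homog.euler {n : ℕ} {k : ℤ} {f : Ambient n × ℝ → ℝ} (h : Homog k f)
    (hf : DifferentiableOn ℝ f (Dom n)) {x : Ambient n} {t : ℝ} (hx : x ≠ 0) (ht : 0 ≤ t) :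
    Dx x f (x, t) = k * f (x, t) := by
  have h1 := hasDerivAt_line hf x x (t := t) (s := 0) (by simp [hx]) ht
  have hz : HasDerivAt (fun s : ℝ => (1 + s) ^ k) ((k : ℝ) * (1 + 0) ^ (k - 1) * 1) 0 := by
    have := (hasDerivAt_zpow k ((1 : ℝ) + 0) (by simp)).comp (0 : ℝ)
      ((hasDerivAt_id (0 : ℝ)).const_add 1)
    simpa [Function.comp_def] using this
  have h2 := hz.mul_const (f (x, t))
  have h3 := h1.congr_of_eventuallyEq (f₁ := fun s => (1 + s) ^ k * f (x, t)) (by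
    filter_upwards [Ioi_mem_nhds (show (-1 : ℝ) < 0 by norm_num)] with s hs
    have hs : 0 < 1 + s := by have := mem_Ioi.1 hs; linarith
    rw [← h (1 + s) x t hs hx ht, add_smul, one_smul])
  have h4 := h3.unique h2
  simpa using h4

/-! ### Homogeneous extensions of the support function -/

/-- The radial projection to the unit sphere (with an arbitrary value at the origin). -/
def toSphere {n : ℕ} (x : Ambient n) : USphere n :=
  if hx : x = 0 then ⟨EuclideanSpace.single 0 1, by simp⟩ else ⟨‖x‖⁻¹ • x, by
    rw [mem_sphere_zero_iff_norm, norm_smul, norm_inv, norm_norm,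
      inv_mul_cancel₀ (norm_ne_zero_iff.mpr hx)]⟩

lemma coe_toSphere {n : ℕ} {x : Ambient n} (hx : x ≠ 0) :
    (toSphere x : Ambient n) = ‖x‖⁻¹ • x := by simp [toSphere, hx]

lemma norm_coe_sphere {n : ℕ} (z : USphere n) : ‖(z : Ambient n)‖ = 1 := by simp

lemma coe_sphere_ne_zero {n : ℕ} (z : USphere n) : (z : Ambient n) ≠ 0 :=
  ne_zero_of_mem_unit_sphere z

lemma toSphere_coe {n : ℕ} (z : USphere n) : toSphere (z : Ambient n) = z := by
  ext1; rw [coe_toSphere (coe_sphere_ne_zero z)]; simp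

lemma norm_smul_toSphere {n : ℕ} {x : Ambient n} (hx : x ≠ 0) :
    ‖x‖ • (toSphere x : Ambient n) = x := by
  rw [coe_toSphere hx, smul_smul, mul_inv_cancel₀ (norm_ne_zero_iff.2 hx), one_smul]

lemma radialExt_eq {n : ℕ} (f : USphere n → ℝ) {x : Ambient n} (hx : x ≠ 0) :
    radialExt f x = f (toSphere x) := by simp [radialExt, toSphere, hx]

lemma toSphere_smul {n : ℕ} {c : ℝ} (hc : 0 < c) {x : Ambient n} (hx : x ≠ 0) :
    toSphere (c • x) = toSphere x := by
  ext1
  rw [coe_toSphere (smul_ne_zero hc.ne' hx), coe_toSphere hx, norm_smul, smul_smul,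
    Real.norm_of_nonneg hc.le]
  congr 1
  field_simp

/-- Restricting the codomain to the sphere is done for a globally smooth map, while `x / |x|` is
smooth only off the origin; hence the detour through the open submanifold of nonzero vectors. -/
lemma contMDiffAt_toSphere {n : ℕ} {x : Ambient n} (hx : x ≠ 0) :
    ContMDiffAt 𝓘(ℝ, Ambient n) (𝓡 n) 4 (toSphere (n := n)) x := by
  have : Fact (Module.finrank ℝ (Ambient n) = n + 1) := ⟨finrank_euclideanSpace_fin⟩
  let U : TopologicalSpace.Opens (Ambient n) := ⟨{0}ᶜ, isOpen_compl_singleton⟩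
  have h1 : ContMDiff 𝓘(ℝ, Ambient n) 𝓘(ℝ, Ambient n) 4
      (fun y : U => ‖(y : Ambient n)‖⁻¹ • (y : Ambient n)) := by
    intro y
    have hy : (y : Ambient n) ≠ 0 := y.2
    refine (contMDiffAt_subtype_iff (U := U)
      (f := fun y : Ambient n => ‖y‖⁻¹ • y) (x := y)).2 ?_
    refine ContDiffAt.contMDiffAt ?_
    exact ((contDiffAt_norm ℝ hy).inv (norm_ne_zero_iff.2 hy)).smul contDiffAt_id
  have h2 : ContMDiff 𝓘(ℝ, Ambient n) (𝓡 n) 4 (fun y : U => toSphere (y : Ambient n)) := by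
    have hm : ∀ y : U, ‖(y : Ambient n)‖⁻¹ • (y : Ambient n) ∈ Metric.sphere (0 : Ambient n) 1 :=
      fun y => by
        rw [← coe_toSphere y.2]
        exact (toSphere (y : Ambient n)).2
    have he : (fun y : U => toSphere (y : Ambient n)) = codRestrict _ _ hm := by
      ext1 y
      ext1
      rw [coe_toSphere y.2]
      rfl
    rw [he]
    exact h1.codRestrict_sphere hm
  exact (contMDiffAt_subtype_iff (U := U) (f := toSphere) (x := ⟨x, hx⟩)).1 (h2 ⟨x, hx⟩)

/-- The extension of `S` that is homogeneous of degree `0` in space. -/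
def ext₀ {n : ℕ} (S : USphere n → ℝ → ℝ) (p : Ambient n × ℝ) : ℝ :=
  radialExt (fun y => S y p.2) p.1

/-- The extension of `S` that is homogeneous of degree `1` in space. -/
def ext₁ {n : ℕ} (S : USphere n → ℝ → ℝ) (p : Ambient n × ℝ) : ℝ := ‖p.1‖ * ext₀ S p

lemma ext₀_eq {n : ℕ} (S : USphere n → ℝ → ℝ) {x : Ambient n} (hx : x ≠ 0) (t : ℝ) :
    ext₀ S (x, t) = S (toSphere x) t := radialExt_eq _ hx

lemma ext₁_eq {n : ℕ} (S : USphere n → ℝ → ℝ) {x : Ambient n} (hx : x ≠ 0) (t : ℝ) :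
    ext₁ S (x, t) = ‖x‖ * S (toSphere x) t := by rw [ext₁, ext₀_eq S hx]

lemma ext₁_coe {n : ℕ} (S : USphere n → ℝ → ℝ) (z : USphere n) (t : ℝ) :
    ext₁ S ((z : Ambient n), t) = S z t := by
  rw [ext₁_eq S (coe_sphere_ne_zero z), toSphere_coe, norm_coe_sphere, one_mul]

lemma homog_ext₁ {n : ℕ} (S : USphere n → ℝ → ℝ) : Homog 1 (ext₁ S) := by
  intro c x t hc hx _
  rw [ext₁_eq S hx, ext₁_eq S (smul_ne_zero hc.ne' hx), toSphere_smul hc hx, norm_smul,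
    Real.norm_of_nonneg hc.le, zpow_one, mul_assoc]

variable {n : ℕ} {α : ℝ} {S : USphere n → ℝ → ℝ}

lemma IsNormalizedSolution.contDiffOn_ext₀ (h : IsNormalizedSolution α S) :
    ContDiffOn ℝ 4 (ext₀ S) (Dom n) := by
  rw [← contMDiffOn_iff_contDiffOn]
  rintro ⟨x, t⟩ hp
  have hx : x ≠ 0 := (mem_Dom.1 hp).1
  have h1 : ContMDiffAt 𝓘(ℝ, Ambient n × ℝ) ((𝓡 n).prod 𝓘(ℝ, ℝ)) 4
      (fun p : Ambient n × ℝ => (toSphere p.1, p.2)) (x, t) := by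
    refine ContMDiffAt.prodMk ?_ contDiff_snd.contMDiff.contMDiffAt
    exact ContMDiffAt.comp (x, t) (contMDiffAt_toSphere hx) contDiff_fst.contMDiff.contMDiffAt
  have hm : MapsTo (fun p : Ambient n × ℝ => (toSphere p.1, p.2)) (Dom n)
      (univ ×ˢ Ici (0 : ℝ)) := fun p hp => ⟨mem_univ _, hp.2⟩
  have h2 := (h.contMDiffOn (toSphere x, t) (hm hp)).comp
    (x, t) (h1.contMDiffWithinAt (s := Dom n)) hm
  refine h2.congr (fun p hp => ?_) ?_
  · exact ext₀_eq S hp.1 p.2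
  · exact ext₀_eq S hx t

lemma contDiffOn_norm_fst {k : ℕ} : ContDiffOn ℝ k (fun p : Ambient n × ℝ => ‖p.1‖) (Dom n) :=
  contDiffOn_fst.norm ℝ (fun _ hp => hp.1)

lemma IsNormalizedSolution.contDiffOn_ext₁ (h : IsNormalizedSolution α S) :
    ContDiffOn ℝ (4 : ℕ) (ext₁ S) (Dom n) :=
  contDiffOn_norm_fst.mul h.contDiffOn_ext₀

lemma contDiffOn_slice {k : ℕ} {f : Ambient n × ℝ → ℝ} (hf : ContDiffOn ℝ k f (Dom n)) {t : ℝ}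
    (ht : 0 ≤ t) : ContDiffOn ℝ k (fun x => f (x, t)) {0}ᶜ :=
  hf.comp (contDiff_id.prodMk contDiff_const).contDiffOn (fun _ hx => mem_Dom.2 ⟨hx, ht⟩)

lemma eventually_line_ne {x : Ambient n} (hx : x ≠ 0) (a : Ambient n) :
    ∀ᶠ s : ℝ in 𝓝 0, x + s • a ≠ 0 :=
  ContinuousAt.eventually_ne (by fun_prop) (by simpa using hx)

lemma hasDerivAt_line_fderiv {F : Type*} [NormedAddCommGroup F] [NormedSpace ℝ F]
    {f : Ambient n → F} {x : Ambient n} (hf : DifferentiableAt ℝ f x)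
    (a : Ambient n) : HasDerivAt (fun s : ℝ => f (x + s • a)) (fderiv ℝ f x a) 0 := by
  have h2 : HasDerivAt (fun s : ℝ => x + s • a) a 0 := by
    simpa using ((hasDerivAt_id (0 : ℝ)).smul_const a).const_add x
  have h1 : HasFDerivAt f (fderiv ℝ f x) (x + (0 : ℝ) • a) := by simpa using hf.hasFDerivAt
  exact h1.comp_hasDerivAt 0 h2

lemma fderiv_slice {f : Ambient n × ℝ → ℝ} (hf : ContDiffOn ℝ (1 : ℕ) f (Dom n)) {x : Ambient n}
    (hx : x ≠ 0) {t : ℝ} (ht : 0 ≤ t) (a : Ambient n) :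
    fderiv ℝ (fun x => f (x, t)) x a = Dx a f (x, t) := by
  have h1 : DifferentiableAt ℝ (fun x => f (x, t)) x :=
    ((contDiffOn_slice hf ht).differentiableOn (by norm_num) x hx).differentiableAt
      (isOpen_compl_singleton.mem_nhds hx)
  have h2 := hasDerivAt_line (hf.differentiableOn (by norm_num)) x a (t := t) (s := 0)
    (by simpa using hx) ht
  simpa using (hasDerivAt_line_fderiv h1 a).unique h2

/-- Both sides are the derivative at `s = 0` of the same function along the line `z + s a` at fixed
time. -/
lemma IsNormalizedSolution.sphHess_eq (h : IsNormalizedSolution α S) (z : USphere n) {t : ℝ}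
    (ht : 0 ≤ t) (a b : Ambient n) :
    sphHess (fun y => S y t) z a b = Dx a (Dx b (ext₀ S)) ((z : Ambient n), t) := by
  have hz := coe_sphere_ne_zero z
  have h0 : ContDiffOn ℝ (4 : ℕ) (ext₀ S) (Dom n) := h.contDiffOn_ext₀
  have h1 : ContDiffAt ℝ (2 : ℕ) (fun x => ext₀ S (x, t)) z :=
    ((contDiffOn_slice h0 ht) z hz).contDiffAt
      (isOpen_compl_singleton.mem_nhds hz) |>.of_le (by norm_num)
  have h2 : DifferentiableAt ℝ (fderiv ℝ (fun x => ext₀ S (x, t))) z :=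
    (h1.fderiv_right (m := 1) (by norm_num)).differentiableAt (by norm_num)
  have h3 := (hasDerivAt_line_fderiv h2 a).clm_apply (hasDerivAt_const 0 b)
  have h4 := hasDerivAt_line (f := Dx b (ext₀ S)) (t := t) (s := 0)
    ((contDiffOn_D (l := 1) h0 (by norm_num) _).differentiableOn (by norm_num)) z a
    (by simpa using hz) ht
  have h5 := h4.congr_of_eventuallyEq
    (f₁ := fun s : ℝ => fderiv ℝ (fun x => ext₀ S (x, t)) (z + s • a) b) (by
      filter_upwards [eventually_line_ne hz a] with s hs
      exact fderiv_slice (h0.of_le (by norm_num)) hs ht b)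
  have h6 := h3.unique h5
  simp only [zero_smul, add_zero, map_zero] at h6
  exact h6

lemma D_mul {f g : Ambient n × ℝ → ℝ} {p : Ambient n × ℝ} (hp : p ∈ Dom n)
    (hf : DifferentiableOn ℝ f (Dom n)) (hg : DifferentiableOn ℝ g (Dom n))
    (w : Ambient n × ℝ) :
    D w (fun q => f q * g q) p = f p * D w g p + D w f p * g p := by
  rw [D, fderivWithin_fun_mul (uniqueDiffOn_Dom n p hp) (hf p hp) (hg p hp)]
  simp [D, mul_comm]

lemma hasDerivAt_norm_line (x a : Ambient n) {s : ℝ} (hx : x + s • a ≠ 0) :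
    HasDerivAt (fun s : ℝ => ‖x + s • a‖) (inner ℝ (x + s • a) a / ‖x + s • a‖) s := by
  have h2 : HasDerivAt (fun s : ℝ => x + s • a) a s := by
    simpa using ((hasDerivAt_id s).smul_const a).const_add x
  have h3 := (h2.norm_sq).sqrt (by positivity)
  simp only [Real.sqrt_sq (norm_nonneg _)] at h3
  convert h3 using 1
  field_simp

lemma differentiableOn_norm_fst : DifferentiableOn ℝ (fun p : Ambient n × ℝ => ‖p.1‖) (Dom n) :=
  (contDiffOn_norm_fst (k := 1)).differentiableOn (by norm_num)

lemma Dx_norm_fst {x : Ambient n} (hx : x ≠ 0) {t : ℝ} (ht : 0 ≤ t) (a : Ambient n) :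
    Dx a (fun p : Ambient n × ℝ => ‖p.1‖) (x, t) = inner ℝ x a / ‖x‖ := by
  have h1 := hasDerivAt_line (differentiableOn_norm_fst (n := n)) x a (t := t) (s := 0)
    (by simpa using hx) ht
  have h2 := hasDerivAt_norm_line x a (s := 0) (by simpa using hx)
  simpa using h1.unique h2

/-- On tangent vectors, the Hessian of the extension of degree one is `∇̄²S + S g`. -/
lemma IsNormalizedSolution.Dx_Dx_ext₁ (h : IsNormalizedSolution α S) (z : USphere n) {t : ℝ}
    (ht : 0 ≤ t) {a b : Ambient n} (ha : inner ℝ (z : Ambient n) a = 0)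
    (hb : inner ℝ (z : Ambient n) b = 0) :
    Dx a (Dx b (ext₁ S)) ((z : Ambient n), t) =
      sphHess (fun y => S y t) z a b + S z t * inner ℝ a b := by
  have hz := coe_sphere_ne_zero z
  have h0 : ContDiffOn ℝ (4 : ℕ) (ext₀ S) (Dom n) := h.contDiffOn_ext₀
  have hd0 : DifferentiableOn ℝ (ext₀ S) (Dom n) := h0.differentiableOn (by norm_num)
  have hd1 : DifferentiableOn ℝ (Dx b (ext₀ S)) (Dom n) :=
    (contDiffOn_D (l := 1) h0 (by norm_num) _).differentiableOn (by norm_num)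
  have key : ∀ x : Ambient n, x ≠ 0 → Dx b (ext₁ S) (x, t) =
      ‖x‖ * Dx b (ext₀ S) (x, t) + inner ℝ x b / ‖x‖ * ext₀ S (x, t) := by
    intro x hx
    have := D_mul (mem_Dom.2 ⟨hx, ht⟩) differentiableOn_norm_fst hd0 (b, 0)
    rw [← Dx_norm_fst hx ht]
    exact this
  have hz0 : (z : Ambient n) + (0 : ℝ) • a ≠ 0 := by simpa using hz
  have hin : HasDerivAt (fun s : ℝ => inner ℝ ((z : Ambient n) + s • a) b) (inner ℝ a b) 0 := by
    have : (fun s : ℝ => inner ℝ ((z : Ambient n) + s • a) b) = fun s => s * inner ℝ a b := by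
      ext s; rw [inner_add_left, hb, inner_smul_left]; simp
    rw [this]
    simpa using (hasDerivAt_id (0 : ℝ)).mul_const (inner ℝ a b)
  have h1 := hasDerivAt_line (f := Dx b (ext₁ S)) (t := t) (s := 0)
    ((contDiffOn_D (l := 1) h.contDiffOn_ext₁ (by norm_num) _).differentiableOn (by norm_num))
    z a hz0 ht
  -- At `s = 0` the derivative of the norm is `⟪z, a⟫ = 0` and `⟪z, b⟫ = 0`, so only the second
  -- derivative of `ext₀ S` and `⟪a, b⟫ S` survive.
  have h2 := ((hasDerivAt_norm_line (z : Ambient n) a hz0).mul (hasDerivAt_line hd1 z a hz0 ht)).add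
    ((hin.div (hasDerivAt_norm_line (z : Ambient n) a hz0) (by simp)).mul
      (hasDerivAt_line hd0 z a hz0 ht))
  have h3 := h1.congr_of_eventuallyEq
    (f₁ := (fun s : ℝ => ‖(z : Ambient n) + s • a‖) *
        (fun s : ℝ => Dx b (ext₀ S) (z + s • a, t)) +
      (fun s : ℝ => inner ℝ ((z : Ambient n) + s • a) b) / (fun s => ‖(z : Ambient n) + s • a‖) *
        (fun s : ℝ => ext₀ S (z + s • a, t))) (by
      filter_upwards [eventually_line_ne hz a] with s hs
      simp [key _ hs])
  have h4 := h2.unique h3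
  have h5 : ext₀ S ((z : Ambient n), t) = S z t := by
    rw [ext₀_eq S hz, toSphere_coe]
  simp only [Pi.div_apply, zero_smul, add_zero, ha, hb, norm_coe_sphere, h5] at h4
  rw [← h4, h.sphHess_eq z ht]
  ring

/-- The time derivative of the extension of degree one. -/
lemma IsNormalizedSolution.D_time_ext₁ (h : IsNormalizedSolution α S) {x : Ambient n} (hx : x ≠ 0)
    {t : ℝ} (ht : 0 ≤ t) :
    D (0, 1) (ext₁ S) (x, t) = ‖x‖ * derivWithin (S (toSphere x)) (Ici 0) t := by
  have h0 : DifferentiableOn ℝ (ext₀ S) (Dom n) := h.contDiffOn_ext₀.differentiableOn (by norm_num)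
  have h1 := hasDerivWithinAt_time
    (h.contDiffOn_ext₁.differentiableOn (by norm_num)) hx ht
  have h2 := hasDerivWithinAt_time h0 hx ht
  have e : (fun t => ext₀ S (x, t)) = S (toSphere x) := funext fun t => ext₀_eq S hx t
  rw [e] at h2
  have h3 := h2.const_mul ‖x‖
  rw [h2.derivWithin (uniqueDiffOn_Ici 0 t ht)]
  have e' : (fun t => ext₁ S (x, t)) = fun t => ‖x‖ * S (toSphere x) t :=
    funext fun t => ext₁_eq S hx t
  rw [e'] at h1
  exact (uniqueDiffOn_Ici (0 : ℝ) t ht).eq_deriv _ h1 h3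

/-! ### Orthonormal frames and the Hessian of the extension -/

/-- `e` is an orthonormal frame of the orthogonal complement of the unit vector `z`. -/
structure IsFrame (z : Ambient n) (e : Fin n → Ambient n) : Prop where
  norm_base : ‖z‖ = 1
  orthonormal : Orthonormal ℝ e
  inner_base : ∀ i, inner ℝ z (e i) = 0

/-- A frame together with the base vector. -/
def IsFrame.basis {z : Ambient n} {e : Fin n → Ambient n} (h : IsFrame z e) :
    OrthonormalBasis (Fin (n + 1)) ℝ (Ambient n) :=
  have hon : Orthonormal ℝ (Fin.cons z e : Fin (n + 1) → Ambient n) := by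
    have hb : ∀ i, inner ℝ (e i) z = 0 := fun i => by rw [real_inner_comm]; exact h.inner_base i
    have ho := orthonormal_iff_ite.1 h.orthonormal
    rw [orthonormal_iff_ite]
    intro i j
    refine Fin.cases ?_ (fun i => ?_) i <;> refine Fin.cases ?_ (fun j => ?_) j
    · simp [h.norm_base]
    · simp [h.inner_base, (Fin.succ_ne_zero j).symm]
    · simp [hb]
    · simp [ho]
  (basisOfOrthonormalOfCardEqFinrank hon (by simp)).toOrthonormalBasis (by simpa using hon)

lemma IsFrame.basis_zero {z : Ambient n} {e : Fin n → Ambient n} (h : IsFrame z e) :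
    h.basis 0 = z := by simp [IsFrame.basis]

lemma IsFrame.basis_succ {z : Ambient n} {e : Fin n → Ambient n} (h : IsFrame z e) (i : Fin n) :
    h.basis i.succ = e i := by simp [IsFrame.basis]

lemma IsFrame.sum_smul {z : Ambient n} {e : Fin n → Ambient n} (h : IsFrame z e)
    (a : Ambient n) : inner ℝ z a • z + ∑ i, inner ℝ (e i) a • e i = a := by
  have := h.basis.sum_repr' a
  rwa [Fin.sum_univ_succ, h.basis_zero, Finset.sum_congr rfl
    (fun i _ => by rw [h.basis_succ i])] at this

lemma IsFrame.sum_inner_mul_inner {z : Ambient n} {e : Fin n → Ambient n} (h : IsFrame z e)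
    (a b : Ambient n) :
    inner ℝ z a * inner ℝ z b + ∑ i, inner ℝ (e i) a * inner ℝ (e i) b = inner ℝ a b := by
  have := h.basis.sum_inner_mul_inner a b
  rw [Fin.sum_univ_succ, h.basis_zero, Finset.sum_congr rfl
    (fun i _ => by rw [h.basis_succ i])] at this
  simpa only [real_inner_comm] using this

lemma isFrame_frame (z : USphere n) : IsFrame (z : Ambient n) (frame z) := by
  have : Fact (Module.finrank ℝ (Ambient n) = n + 1) := ⟨finrank_euclideanSpace_fin⟩
  refine ⟨norm_coe_sphere z, ?_, fun i => ?_⟩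
  · exact (OrthonormalBasis.fromOrthogonalSpanSingleton (𝕜 := ℝ) n
      (ne_zero_of_mem_unit_sphere z)).orthonormal.comp_linearIsometry (Submodule.subtypeₗᵢ _)
  · exact Submodule.mem_orthogonal_singleton_iff_inner_right.1
      (OrthonormalBasis.fromOrthogonalSpanSingleton (𝕜 := ℝ) n
        (ne_zero_of_mem_unit_sphere z) i).2

/-- At a point only the outer derivative is visibly linear in its direction; symmetry brings the
inner one outside. -/
lemma Dx_Dx_sum {f : Ambient n × ℝ → ℝ} (hf : ContDiffOn ℝ 2 f (Dom n))
    {p : Ambient n × ℝ} (hp : p ∈ Dom n) {ι κ : Type*} (s : Finset ι) (r : Finset κ) (c : ι → ℝ)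
    (d : κ → ℝ) (a : ι → Ambient n) (b : κ → Ambient n) :
    Dx (∑ i ∈ s, c i • a i) (Dx (∑ j ∈ r, d j • b j) f) p =
      ∑ i ∈ s, ∑ j ∈ r, c i * d j * Dx (a i) (Dx (b j) f) p := by
  rw [Dx_sum]
  refine Finset.sum_congr rfl fun i _ => ?_
  rw [Dx_smul, Dx_comm hf hp, Dx_sum, Finset.mul_sum]
  refine Finset.sum_congr rfl fun j _ => ?_
  rw [Dx_smul, Dx_comm hf hp]
  ring

/-- The Hessian of the extension of degree one in the directions of a family of vectors. -/
def hessExt (S : USphere n → ℝ → ℝ) (e : Fin n → Ambient n) (p : Ambient n × ℝ) :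
    Matrix (Fin n) (Fin n) ℝ := Matrix.of fun i j => Dx (e i) (Dx (e j) (ext₁ S)) p

lemma IsNormalizedSolution.contDiffOn_two (h : IsNormalizedSolution α S) :
    ContDiffOn ℝ 2 (ext₁ S) (Dom n) := h.contDiffOn_ext₁.of_le (by norm_num)

lemma IsNormalizedSolution.differentiableOn_ext₁ (h : IsNormalizedSolution α S) :
    DifferentiableOn ℝ (ext₁ S) (Dom n) := h.contDiffOn_two.differentiableOn (by norm_num)

lemma IsNormalizedSolution.differentiableOn_Dx (h : IsNormalizedSolution α S) (a : Ambient n) :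
    DifferentiableOn ℝ (Dx a (ext₁ S)) (Dom n) :=
  (contDiffOn_D (l := 1) h.contDiffOn_ext₁ (by norm_num) _).differentiableOn (by norm_num)

lemma IsNormalizedSolution.hessExt_frame (h : IsNormalizedSolution α S) (z : USphere n) {t : ℝ}
    (ht : 0 ≤ t) {e : Fin n → Ambient n} (he : IsFrame (z : Ambient n) e) (i j : Fin n) :
    hessExt S e (z, t) i j = sphHess (fun y => S y t) z (e i) (e j) +
      S z t * (1 : Matrix (Fin n) (Fin n) ℝ) i j := by
  rw [hessExt, of_apply, h.Dx_Dx_ext₁ z ht (he.inner_base i) (he.inner_base j),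
    orthonormal_iff_ite.1 he.orthonormal, one_apply]

lemma IsNormalizedSolution.hessExt_eq_radiiMatrix (h : IsNormalizedSolution α S) (z : USphere n)
    {t : ℝ} (ht : 0 ≤ t) : hessExt S (frame z) (z, t) = radiiMatrix (fun y => S y t) z := by
  ext i j
  rw [h.hessExt_frame z ht (isFrame_frame z)]
  simp [radiiMatrix, hessMatrix]

/-- The radial direction is in the kernel of the Hessian of the extension of degree one. -/
lemma IsNormalizedSolution.Dx_Dx_radial (h : IsNormalizedSolution α S) {x : Ambient n}
    (hx : x ≠ 0) {t : ℝ} (ht : 0 ≤ t) (b : Ambient n) :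
    Dx x (Dx b (ext₁ S)) (x, t) = 0 := by
  rw [((homog_ext₁ S).dx h.differentiableOn_ext₁ b).euler (h.differentiableOn_Dx b) hx ht]
  simp

/-- Second derivatives of a function of degree one have degree `-1`. -/
lemma IsNormalizedSolution.Dx_Dx_smul (h : IsNormalizedSolution α S) {x : Ambient n}
    (hx : x ≠ 0) {t : ℝ} (ht : 0 ≤ t) (a b : Ambient n) :
    Dx a (Dx b (ext₁ S)) (x, t) = ‖x‖⁻¹ * Dx a (Dx b (ext₁ S)) ((toSphere x : Ambient n), t) := by
  have h1 := ((homog_ext₁ S).dx h.differentiableOn_ext₁ b).dx (h.differentiableOn_Dx b) a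
    ‖x‖ (toSphere x) t (norm_pos_iff.2 hx) (coe_sphere_ne_zero _) ht
  rw [norm_smul_toSphere hx] at h1
  rw [h1]
  simp

/-- The Hessian of the extension of degree one at a point of the sphere, in terms of an orthonormal
frame. -/
lemma IsNormalizedSolution.Dx_Dx_eq_sum (h : IsNormalizedSolution α S) {z : Ambient n}
    {f : Fin n → Ambient n} (hf : IsFrame z f) {t : ℝ} (ht : 0 ≤ t) (a b : Ambient n) :
    Dx a (Dx b (ext₁ S)) (z, t) =
      ∑ k, ∑ l, inner ℝ (f k) a * inner ℝ (f l) b * hessExt S f (z, t) k l := by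
  have hz : z ≠ 0 := norm_pos_iff.1 (by rw [hf.norm_base]; norm_num)
  have hp : (z, t) ∈ Dom n := mem_Dom.2 ⟨hz, ht⟩
  conv_lhs => rw [← hf.sum_smul a]
  rw [Dx_add, Dx_smul, h.Dx_Dx_radial hz ht, mul_zero, zero_add, Dx_comm h.contDiffOn_two hp]
  conv_lhs => rw [← hf.sum_smul b]
  rw [Dx_add, Dx_smul, h.Dx_Dx_radial hz ht, mul_zero, zero_add, Dx_comm h.contDiffOn_two hp,
    Dx_Dx_sum h.contDiffOn_two hp]
  rfl

/-- The determinant of the Hessian in the gnomonic projection. -/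
lemma IsNormalizedSolution.det_hessExt (h : IsNormalizedSolution α S) {z₀ : Ambient n}
    {e : Fin n → Ambient n} (he : IsFrame z₀ e) {x : Ambient n} (hx : inner ℝ z₀ x = 1)
    {t : ℝ} (ht : 0 ≤ t) :
    (hessExt S e (x, t)).det =
      (‖x‖ ^ (n + 2))⁻¹ * (radiiMatrix (fun y => S y t) (toSphere x)).det := by
  have hx0 : x ≠ 0 := by rintro rfl; simp at hx
  have hf := isFrame_frame (toSphere x)
  set z : Ambient n := (toSphere x : Ambient n) with hz
  set f := frame (toSphere x)
  -- `B` holds the tangential coordinates, at the projection of `x`, of the fixed frame `e`; radial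
  -- components do not affect the Hessian.
  let B : Matrix (Fin n) (Fin n) ℝ := Matrix.of fun i k => inner ℝ (f k) (e i)
  have h1 : hessExt S e (x, t) =
      ‖x‖⁻¹ • (B * radiiMatrix (fun y => S y t) (toSphere x) * Bᵀ) := by
    ext i j
    rw [hessExt, of_apply, h.Dx_Dx_smul hx0 ht, h.Dx_Dx_eq_sum hf ht,
      show hessExt S f (z, t) = _ from h.hessExt_eq_radiiMatrix _ ht]
    simp only [Matrix.smul_apply, Matrix.mul_apply, Matrix.transpose_apply, B, of_apply,
      smul_eq_mul, Finset.sum_mul]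
    rw [Finset.sum_comm]
    congr 1
    refine Finset.sum_congr rfl fun k _ => Finset.sum_congr rfl fun l _ => ?_
    ring
  have h2 : B * Bᵀ = 1 + replicateCol Unit (fun i => -inner ℝ z (e i)) *
      replicateRow Unit (fun i => inner ℝ z (e i)) := by
    ext i j
    have := hf.sum_inner_mul_inner (e i) (e j)
    rw [orthonormal_iff_ite.1 he.orthonormal] at this
    simp only [Matrix.mul_apply, Matrix.transpose_apply, B, of_apply, Matrix.add_apply, one_apply,
      replicateCol_apply, replicateRow_apply, Finset.univ_unique, Finset.sum_singleton]
    linarith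
  -- The matrix determinant lemma gives `1 - ∑ ⟪z, e_i⟫² = ⟪z₀, z⟫² = |x|⁻²`. The other `n` powers
  -- of `|x|⁻¹` come from the degree of the Hessian.
  have h3 : B.det * B.det = (‖x‖ ^ 2)⁻¹ := by
    have h4 : B.det * B.det = (B * Bᵀ).det := by rw [det_mul, det_transpose]
    rw [h4, h2, det_one_add_replicateCol_mul_replicateRow]
    have h5 := he.sum_inner_mul_inner z z
    have h6 : inner ℝ z₀ z = ‖x‖⁻¹ := by
      rw [hz, coe_toSphere hx0, inner_smul_right, hx, mul_one]
    rw [h6, real_inner_self_eq_norm_sq, hf.norm_base] at h5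
    have h7 : (fun i => inner ℝ z (e i)) ⬝ᵥ (fun i => -inner ℝ z (e i)) =
        - ∑ i, inner ℝ (e i) z * inner ℝ (e i) z := by
      simp [dotProduct, real_inner_comm]
    rw [h7]
    rw [← inv_pow, sq]
    linarith
  rw [h1, det_smul, det_mul, det_mul, det_transpose, Fintype.card_fin]
  calc _ = ‖x‖⁻¹ ^ n * (B.det * B.det) * (radiiMatrix (fun y => S y t) (toSphere x)).det := by ring
    _ = _ := by rw [h3, pow_add, mul_inv, inv_pow]

/-- The Hessian of the extension of degree one is positive on nonradial directions. -/
lemma IsNormalizedSolution.Dx_Dx_pos (h : IsNormalizedSolution α S) {x a : Ambient n}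
    (hx : x ≠ 0) {t : ℝ} (ht : 0 ≤ t) (ha : ∀ c : ℝ, a ≠ c • x) :
    0 < Dx a (Dx a (ext₁ S)) (x, t) := by
  rw [h.Dx_Dx_smul hx ht, h.Dx_Dx_eq_sum (isFrame_frame (toSphere x)) ht,
    h.hessExt_eq_radiiMatrix _ ht]
  refine mul_pos (inv_pos.2 (norm_pos_iff.2 hx)) ?_
  set c : Fin n → ℝ := fun k => inner ℝ (frame (toSphere x) k) a with hc
  have hne : c ≠ 0 := by
    intro h0
    have h1 := (isFrame_frame (toSphere x)).sum_smul a
    have h2 : ∀ k, inner ℝ (frame (toSphere x) k) a = 0 := fun k => congrFun h0 k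
    simp only [h2, zero_smul, Finset.sum_const_zero, add_zero] at h1
    rw [coe_toSphere hx, smul_smul] at h1
    exact ha _ h1.symm
  have h3 := (h.posDef (toSphere x) t ht).dotProduct_mulVec_pos hne
  refine h3.trans_eq ?_
  simp only [dotProduct, mulVec, Finset.mul_sum, star_trivial]
  refine Finset.sum_congr rfl fun k _ => Finset.sum_congr rfl fun l _ => ?_
  ring

/-- A frame that diagonalizes the Hessian of the extension of degree one. -/
lemma IsNormalizedSolution.exists_eigenframe (h : IsNormalizedSolution α S) (z : USphere n) {t : ℝ}
    (ht : 0 ≤ t) : ∃ (e : Fin n → Ambient n) (lam : Fin n → ℝ), IsFrame (z : Ambient n) e ∧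
      (∀ i, 0 < lam i) ∧ hessExt S e (z, t) = diagonal lam := by
  have hW := h.posDef z t ht
  set W := radiiMatrix (fun y => S y t) z with hWdef
  let U := hW.isHermitian.eigenvectorBasis
  have hf := isFrame_frame z
  have hfo := orthonormal_iff_ite.1 hf.orthonormal
  -- Eigenvectors of the radii matrix are read as coordinates in the given frame.
  let e : Fin n → Ambient n := fun k => ∑ i, U k i • frame z i
  have hfe : ∀ i k, inner ℝ (frame z i) (e k) = U k i := fun i k => by
    simp [e, inner_sum, inner_smul_right, hfo]
  have he : IsFrame (z : Ambient n) e := by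
    have hz : ∀ k, inner ℝ (z : Ambient n) (e k) = 0 := fun k => by
      simp [e, inner_sum, inner_smul_right, hf.inner_base]
    refine ⟨hf.norm_base, ?_, hz⟩
    rw [orthonormal_iff_ite]
    intro k l
    rw [← orthonormal_iff_ite.1 U.orthonormal k l, ← hf.sum_inner_mul_inner, hz, zero_mul,
      zero_add, PiLp.inner_apply]
    refine Finset.sum_congr rfl fun i _ => ?_
    simp [hfe, mul_comm]
  refine ⟨e, hW.isHermitian.eigenvalues, he, fun i => hW.eigenvalues_pos i, ?_⟩
  ext k l
  rw [hessExt, of_apply, h.Dx_Dx_eq_sum hf ht, h.hessExt_eq_radiiMatrix _ ht, ← hWdef]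
  simp only [hfe]
  have h1 := hW.isHermitian.mulVec_eigenvectorBasis l
  have h2 := orthonormal_iff_ite.1 U.orthonormal k l
  calc ∑ i, ∑ j, U k i * U l j * W i j = ∑ i, U k i * (W *ᵥ ⇑(U l)) i := by
        refine Finset.sum_congr rfl fun i _ => ?_
        rw [mulVec, dotProduct, Finset.mul_sum]
        exact Finset.sum_congr rfl fun j _ => by ring
    _ = hW.isHermitian.eigenvalues l * inner ℝ (U k) (U l) := by
        rw [h1, PiLp.inner_apply, Finset.mul_sum]
        refine Finset.sum_congr rfl fun i _ => ?_
        simp [U]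
        ring
    _ = _ := by
        rw [h2, diagonal_apply]
        split_ifs with hkl <;> simp [hkl]

/-! ### Derivatives of the logarithm of a determinant -/

section LogDet

variable {ι : Type*} [Fintype ι] [DecidableEq ι]

/-- Jacobi's formula. -/
lemma hasDerivAt_det {M : ℝ → Matrix ι ι ℝ} {M' : Matrix ι ι ℝ} {s : ℝ}
    (hM : ∀ i j, HasDerivAt (fun s => M s i j) (M' i j) s) :
    HasDerivAt (fun s => (M s).det) (trace (adjugate (M s) * M')) s := by
  have h1 : HasDerivAt (fun s => ∑ σ : Equiv.Perm ι, (Equiv.Perm.sign σ : ℝ) * ∏ i, M s (σ i) i)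
      (∑ σ : Equiv.Perm ι, (Equiv.Perm.sign σ : ℝ) *
        ∑ i, (∏ j ∈ Finset.univ.erase i, M s (σ j) j) • M' (σ i) i) s := by
    refine HasDerivAt.fun_sum fun σ _ => HasDerivAt.const_mul _ ?_
    exact HasDerivAt.fun_finsetProd fun i _ => hM (σ i) i
  have h2 : (fun s => (M s).det) =
      fun s => ∑ σ : Equiv.Perm ι, (Equiv.Perm.sign σ : ℝ) * ∏ i, M s (σ i) i := by
    ext s; rw [det_apply']
  rw [h2]
  convert h1 using 1
  have h3 : trace (adjugate (M s) * M') = ∑ i, ((M s).updateCol i (M'.col i)).det := by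
    rw [trace]
    refine Finset.sum_congr rfl fun i _ => ?_
    rw [← cramer_apply, cramer_eq_adjugate_mulVec]
    rfl
  rw [h3]
  simp only [det_apply', Finset.mul_sum]
  rw [Finset.sum_comm]
  refine Finset.sum_congr rfl fun σ _ => Finset.sum_congr rfl fun i _ => ?_
  rw [← Finset.prod_erase_mul _ _ (Finset.mem_univ i), updateCol_self, smul_eq_mul]
  congr 2
  refine Finset.prod_congr rfl fun j hj => ?_
  rw [updateCol_ne (Finset.ne_of_mem_erase hj)]

lemma hasDerivAt_log_det {M : ℝ → Matrix ι ι ℝ} {M' : Matrix ι ι ℝ} {s : ℝ}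
    (hM : ∀ i j, HasDerivAt (fun s => M s i j) (M' i j) s) (hpos : (M s).det ≠ 0) :
    HasDerivAt (fun s => Real.log (M s).det) (trace ((M s)⁻¹ * M')) s := by
  convert (hasDerivAt_det hM).log hpos using 1
  rw [inv_def, Ring.inverse_eq_inv', smul_mul, trace_smul, smul_eq_mul]
  field_simp

-- The operator norm makes matrices a normed algebra, where the derivative of the ring inverse is
-- known; entries are read off afterwards.
open scoped Matrix.Norms.Operator in
lemma hasDerivAt_matrix_inv {M : ℝ → Matrix ι ι ℝ} {M' : Matrix ι ι ℝ} {s : ℝ}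
    (hM : ∀ i j, HasDerivAt (fun s => M s i j) (M' i j) s) (hpos : (M s).det ≠ 0) (i j : ι) :
    HasDerivAt (fun s => (M s)⁻¹ i j) (-((M s)⁻¹ * M' * (M s)⁻¹) i j) s := by
  have h1 : HasDerivAt M M' s := hasDerivAt_pi.2 fun i => hasDerivAt_pi.2 fun j => hM i j
  obtain ⟨u, hu⟩ := (isUnit_iff_isUnit_det _).2 (isUnit_iff_ne_zero.2 hpos)
  have h2 := hasFDerivAt_ringInverse (𝕜 := ℝ) u
  rw [hu] at h2
  have h3 := h2.comp_hasDerivAt s h1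
  have hinv : ((u⁻¹ : (Matrix ι ι ℝ)ˣ) : Matrix ι ι ℝ) = (M s)⁻¹ := by
    rw [← hu, coe_units_inv]
  rw [hinv] at h3
  have h4 := hasDerivAt_pi.1 (hasDerivAt_pi.1 h3 i) j
  simpa [nonsing_inv_eq_ringInverse, Function.comp_def] using h4

/-- The second derivative of `log det` at a diagonal matrix. -/
lemma hasDerivAt_trace_inv_mul {M M₁ : ℝ → Matrix ι ι ℝ} {M₂ : Matrix ι ι ℝ} {lam : ι → ℝ} {s : ℝ}
    (hM : ∀ i j, HasDerivAt (fun s => M s i j) (M₁ s i j) s)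
    (hM₁ : ∀ i j, HasDerivAt (fun s => M₁ s i j) (M₂ i j) s)
    (hlam : ∀ i, lam i ≠ 0) (hdiag : M s = diagonal lam) :
    HasDerivAt (fun s => trace ((M s)⁻¹ * M₁ s))
      (∑ i, (lam i)⁻¹ * M₂ i i - ∑ i, ∑ j, (lam i)⁻¹ * (lam j)⁻¹ * (M₁ s i j * M₁ s j i)) s := by
  have hdet : (M s).det ≠ 0 := by
    rw [hdiag, det_diagonal]; exact Finset.prod_ne_zero_iff.2 fun i _ => hlam i
  have hinv : (M s)⁻¹ = diagonal fun i => (lam i)⁻¹ := by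
    refine inv_eq_left_inv ?_
    rw [hdiag, diagonal_mul_diagonal]
    simp [hlam]
  have h1 : HasDerivAt (fun s => ∑ i, ∑ j, (M s)⁻¹ i j * M₁ s j i)
      (∑ i, ∑ j, (-((M s)⁻¹ * M₁ s * (M s)⁻¹) i j * M₁ s j i + (M s)⁻¹ i j * M₂ j i)) s :=
    HasDerivAt.fun_sum fun i _ => HasDerivAt.fun_sum fun j _ =>
      (hasDerivAt_matrix_inv hM hdet i j).mul (hM₁ j i)
  have h2 : (fun s => trace ((M s)⁻¹ * M₁ s)) =
      fun s => ∑ i, ∑ j, (M s)⁻¹ i j * M₁ s j i := by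
    ext s; simp [trace, Matrix.mul_apply]
  rw [h2]
  convert h1 using 1
  rw [← Finset.sum_sub_distrib]
  refine Finset.sum_congr rfl fun i _ => ?_
  rw [Finset.sum_add_distrib, hinv]
  simp only [diagonal_mul, mul_diagonal]
  rw [Finset.sum_eq_single i (f := fun j => diagonal (fun i => (lam i)⁻¹) i j * M₂ j i)
    (fun j _ hj => by rw [diagonal_apply_ne _ hj.symm, zero_mul]) (by simp), diagonal_apply_eq,
    sub_eq_neg_add, ← Finset.sum_neg_distrib]
  congr 1
  refine Finset.sum_congr rfl fun j _ => ?_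
  ring

lemma trace_inv_mul_diagonal {M M₁ : Matrix ι ι ℝ} {lam : ι → ℝ}
    (hlam : ∀ i, lam i ≠ 0) (hdiag : M = diagonal lam) :
    trace (M⁻¹ * M₁) = ∑ i, (lam i)⁻¹ * M₁ i i := by
  have hinv : M⁻¹ = diagonal fun i => (lam i)⁻¹ := by
    refine inv_eq_left_inv ?_
    rw [hdiag, diagonal_mul_diagonal]
    simp [hlam]
  simp [hinv, trace]

end LogDet

/-! ### One-variable derivative tests -/

section Tests

/-- The second derivative test at a maximum on a line. -/
lemma second_deriv_nonpos {g g' : ℝ → ℝ} {c : ℝ} (hg : ∀ s, HasDerivAt g (g' s) s)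
    (hg' : HasDerivAt g' c 0) (hmax : ∀ s, g s ≤ g 0) : c ≤ 0 := by
  by_contra! hc
  have hm : IsLocalMax g 0 := Filter.Eventually.of_forall hmax
  have hd : deriv g = g' := funext fun s => (hg s).deriv
  have h0 : g' 0 = 0 := hm.hasDerivAt_eq_zero (hg 0)
  -- Were `c` positive, `0` would be a local minimum as well as a maximum, so `g` would be locally
  -- constant and `c = 0`.
  have hmin : IsLocalMin g 0 := isLocalMin_of_deriv_deriv_pos
    (by rw [hd, hg'.deriv]; exact hc) (by rw [hd, h0]) (hg 0).continuousAt
  have h1 : ∀ᶠ s in 𝓝 (0 : ℝ), g s = g 0 := by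
    filter_upwards [hmin] with s hs using le_antisymm (hmax s) hs
  have h2 : ∀ᶠ s in 𝓝 (0 : ℝ), g' s = 0 := by
    filter_upwards [h1.eventually_nhds] with s hs
    exact (hg s).unique ((hasDerivAt_const s (g 0)).congr_of_eventuallyEq hs)
  have h3 : HasDerivAt g' 0 0 := (hasDerivAt_const (0 : ℝ) (0 : ℝ)).congr_of_eventuallyEq h2
  exact hc.ne' (hg'.unique h3)

/-- The first derivative test at a maximum over earlier times. -/
lemma deriv_nonneg_of_left_max {g : ℝ → ℝ} {c t : ℝ} (hg : HasDerivAt g c t) (ht : 0 < t)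
    (hmax : ∀ s, 0 ≤ s → s ≤ t → g s ≤ g t) : 0 ≤ c := by
  have h1 := hg.hasDerivWithinAt (s := Iio t)
  rw [hasDerivWithinAt_iff_tendsto_slope' (by simp)] at h1
  refine ge_of_tendsto h1 ?_
  filter_upwards [inter_mem_nhdsWithin _ (Ioi_mem_nhds ht)] with s hs
  rw [slope_def_field]
  exact div_nonneg_of_nonpos (by have := hmax s (le_of_lt hs.2) (le_of_lt hs.1); linarith)
    (by have := hs.1.out; linarith)

end Tests

/-! ### Calculus and algebra at an interior maximum -/

/-- The threshold for the largest principal radius at an interior maximum of the test function. -/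
def radiusBound (n : ℕ) (α m M : ℝ) : ℝ :=
  1 + (n * α + (2 + M ^ 2) * (1 + n * α) / m + n * α * M) / α

/-- The pointwise inequalities at an interior maximum of the test function are only compatible
with a bounded largest principal radius. -/
lemma lt_radiusBound {n : ℕ} {α m M γ v ρ q : ℝ} (hα : 0 < α) (hm : 0 < m)
    (hγ : 2 * γ = 1 - α * (n + 2)) (hmv : m ≤ v) (hvM : v ≤ M) (hρ : 0 ≤ ρ)
    {lam g B C : Fin n → ℝ} {N T : Fin n → Fin n → ℝ} {o : Fin n} (hlam : ∀ k, 0 < lam k)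
    (hT : ∀ k, T k o = C k) (hg : ∑ i, g i ^ 2 + v ^ 2 ≤ M ^ 2)
    (hs : ∀ k, B k / lam o - (C k / lam o) ^ 2 + (1 + (2 + M ^ 2) + 2 * if k = o then 1 else 0) -
      (2 + M ^ 2) * (lam k / v - (g k / v) ^ 2) + lam k ^ 2 + ∑ i, g i * N k i - v * lam k ≤ 0)
    (ht : 0 ≤ (lam o / (n + 1) - ρ * (q ^ 2 + (2 * γ - α * (∑ j, (lam j)⁻¹ * B j -
        ∑ i, ∑ j, (lam i)⁻¹ * (lam j)⁻¹ * (T i j * T i j))))) / lam o -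
      (2 + M ^ 2) * ((v / (n + 1) - ρ) / v) +
      ∑ i, g i * (g i / (n + 1) - ρ * -(α * ∑ j, (lam j)⁻¹ * N j i)) +
      v * (v / (n + 1) - ρ)) :
    lam o < radiusBound n α m M := by
  by_contra! hbig
  -- Dictionary: `lam` are the radii, `v` is `u`, `g` the tangential gradient, `B k = u_kkoo`, `C k
  -- = u_koo`, `T i j = u_oij`, `N k i = u_kki`; `ρ` is `1/η` times the speed factor, `q` the
  -- logarithmic derivative of that factor along `e_o`.
  set A : ℝ := 2 + M ^ 2 with hA
  set a := lam o with ha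
  have hv : 0 < v := hm.trans_le hmv
  have hM : 0 < M := hv.trans_le hvM
  have hA0 : 0 < A := by positivity
  have hn : (0 : ℝ) ≤ n := n.cast_nonneg
  have hb1 : 1 ≤ a := by
    refine le_trans ?_ hbig
    rw [radiusBound]
    have : 0 ≤ (n * α + (2 + M ^ 2) * (1 + n * α) / m + n * α * M) / α := by positivity
    linarith
  have ha0 : 0 < a := by linarith
  have hb2 : n * α + A * (1 + n * α) / m + n * α * M ≤ α * a := by
    have h1 : (n * α + A * (1 + n * α) / m + n * α * M) / α ≤ a := by
      rw [radiusBound] at hbig; linarith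
    rw [div_le_iff₀ hα] at h1
    linarith
  set SB := ∑ j, (lam j)⁻¹ * B j with hSB
  set ST := ∑ i, ∑ j, (lam i)⁻¹ * (lam j)⁻¹ * (T i j * T i j) with hST
  set SN := ∑ i, g i * ∑ j, (lam j)⁻¹ * N j i with hSN
  set SC := ∑ k, (lam k)⁻¹ * C k ^ 2 with hSC
  set SL := ∑ k, lam k with hSL
  set SI := ∑ k, (lam k)⁻¹ with hSI
  have hSI0 : 0 ≤ SI := Finset.sum_nonneg fun k _ => (inv_pos.2 (hlam k)).le
  have haSL : a ≤ SL := Finset.single_le_sum (fun k _ => (hlam k).le) (Finset.mem_univ o)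
  -- Only the terms `j = o` of the double sum are kept; they absorb the squares `(C k / a)²` from
  -- the derivative of `log u_oo`.
  have hSTC : SC * a⁻¹ ≤ ST := by
    rw [hSC, hST, Finset.sum_mul]
    refine Finset.sum_le_sum fun k _ => ?_
    have h1 := Finset.single_le_sum (s := Finset.univ)
      (f := fun j => (lam k)⁻¹ * (lam j)⁻¹ * (T k j * T k j)) (fun j _ => by
        have := hlam k
        have := hlam j
        have := mul_self_nonneg (T k j)
        positivity) (Finset.mem_univ o)
    simp only [hT] at h1
    rw [← ha] at h1
    linarith
  -- The second-order conditions are summed with weights `1/λ_k`, as in the linearized operator; the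
  -- nonnegative terms with `(g k / v)²` are dropped.
  have hX : SB / a - SC / a ^ 2 + (1 + A) * SI + 2 * a⁻¹ - A * n / v + SL + SN - n * v ≤ 0 := by
    have h1 : ∑ k, (lam k)⁻¹ * (B k / a - (C k / a) ^ 2 +
        (1 + A + 2 * if k = o then 1 else 0) - A * (lam k / v - (g k / v) ^ 2) + lam k ^ 2 +
        ∑ i, g i * N k i - v * lam k) ≤ 0 :=
      Finset.sum_nonpos fun k _ => mul_nonpos_of_nonneg_of_nonpos (inv_pos.2 (hlam k)).le (hs k)
    have h2 : ∀ k, (lam k)⁻¹ * B k / a - (lam k)⁻¹ * C k ^ 2 / a ^ 2 + (1 + A) * (lam k)⁻¹ +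
        (if k = o then 2 * a⁻¹ else 0) - A / v + lam k + ∑ i, g i * ((lam k)⁻¹ * N k i) - v ≤
        (lam k)⁻¹ * (B k / a - (C k / a) ^ 2 +
        (1 + A + 2 * if k = o then 1 else 0) - A * (lam k / v - (g k / v) ^ 2) + lam k ^ 2 +
        ∑ i, g i * N k i - v * lam k) := by
      intro k
      have hk := hlam k
      have h3 : ∑ i, g i * ((lam k)⁻¹ * N k i) = (lam k)⁻¹ * ∑ i, g i * N k i := by
        rw [Finset.mul_sum]
        exact Finset.sum_congr rfl fun i _ => by ring
      have h4 : (if k = o then 2 * a⁻¹ else 0) = (lam k)⁻¹ * (2 * if k = o then 1 else 0) := by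
        split_ifs with hko
        · rw [hko, ha]; ring
        · simp
      have h5 : 0 ≤ (lam k)⁻¹ * (A * (g k / v) ^ 2) := by positivity
      have h6 : (lam k)⁻¹ * lam k = 1 := inv_mul_cancel₀ hk.ne'
      rw [h3, h4]
      have h7 : (lam k)⁻¹ * (lam k / v) = 1 / v := by rw [← mul_div_assoc, h6]
      have h8 : (lam k)⁻¹ * lam k ^ 2 = lam k := by rw [sq, ← mul_assoc, h6, one_mul]
      have h9 : (lam k)⁻¹ * (v * lam k) = v := by rw [mul_left_comm, h6, mul_one]
      have h10 : (lam k)⁻¹ * (C k / a) ^ 2 = (lam k)⁻¹ * C k ^ 2 / a ^ 2 := by ring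
      have h11 : (lam k)⁻¹ * (B k / a) = (lam k)⁻¹ * B k / a := by ring
      simp only [mul_add, mul_sub] at h5 ⊢
      rw [h8, h9, h10, h11, mul_left_comm _ A (lam k / v), h7]
      have h12 : A / v = A * (1 / v) := by ring
      linarith
    have h3 := (Finset.sum_le_sum fun k (_ : k ∈ Finset.univ) => h2 k).trans h1
    simp only [Finset.sum_add_distrib, Finset.sum_sub_distrib, ← Finset.sum_div,
      ← Finset.mul_sum, Finset.sum_ite_eq', Finset.mem_univ, if_true, Finset.sum_const,
      Finset.card_univ, Fintype.card_fin, nsmul_eq_mul] at h3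
    rw [Finset.sum_comm] at h3
    have h4 : ∑ i, ∑ k, g i * ((lam k)⁻¹ * N k i) = SN := by
      simp only [hSN, Finset.mul_sum]
    rw [h4] at h3
    have h5 : (n : ℝ) * A / v = A * n / v := by ring
    rw [h5] at h3
    exact h3
  have hgN : ∑ i, g i * (g i / (n + 1) - ρ * -(α * ∑ j, (lam j)⁻¹ * N j i)) =
      (∑ i, g i ^ 2) / (n + 1) + ρ * (α * SN) := by
    rw [hSN, Finset.sum_div, Finset.mul_sum, Finset.mul_sum, ← Finset.sum_add_distrib]
    exact Finset.sum_congr rfl fun i _ => by ring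
  rw [hgN] at ht
  -- `Y` collects everything multiplied by `ρ`.
  set Y := -(q ^ 2 + 2 * γ) / a + α * (SB - ST) / a + A / v + α * SN - v with hY
  have ht' : 0 ≤ (1 - A + (∑ i, g i ^ 2 + v ^ 2)) / (n + 1) + ρ * Y := by
    refine ht.trans_eq ?_
    rw [hY]
    field_simp
    ring
  -- With `A = 2 + M²` the numerator is at most `-1`. It then suffices that `Y ≤ 0`, whatever the
  -- size of `ρ`.
  have hfirst : (1 - A + (∑ i, g i ^ 2 + v ^ 2)) / (n + 1) < 0 :=
    div_neg_of_neg_of_pos (by linarith) (by positivity)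
  -- Inserting `hX` eliminates fourth- and third-order terms. The `2α/a` coming from `γ` cancels
  -- against the extra `2/a` of the direction `k = o`; then `-α ∑ λ_k ≤ -α a` beats the bounded
  -- remainder.
  have hYle : Y ≤ 0 := by
    have e1 : SC * a⁻¹ / a ≤ ST / a := div_le_div_of_nonneg_right hSTC ha0.le
    have e2 : SC / a ^ 2 = SC * a⁻¹ / a := by field_simp
    have e3 : 0 ≤ q ^ 2 / a := by positivity
    have e4 : Y = α * (SB / a - ST / a + SN) - q ^ 2 / a +
        (n * α - 1) * a⁻¹ + 2 * α * a⁻¹ + A / v - v := by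
      rw [hY, hγ]; field_simp; ring
    have e5 : n * α * a⁻¹ ≤ n * α :=
      mul_le_of_le_one_right (by positivity) (inv_le_one_of_one_le₀ hb1)
    have e6 : A * (1 + n * α) / v ≤ A * (1 + n * α) / m :=
      div_le_div_of_nonneg_left (by positivity) hm hmv
    have e7 : A * (1 + n * α) / v = A / v + α * (A * n / v) := by field_simp
    have e8 : n * α * v ≤ n * α * M := mul_le_mul_of_nonneg_left hvM (by positivity)
    have e9 : α * (SB / a - ST / a + SN) ≤ α * (A * n / v - (1 + A) * SI - 2 * a⁻¹ - SL + n * v) :=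
      mul_le_mul_of_nonneg_left (by rw [e2] at hX; linarith) hα.le
    have e10 : 0 ≤ α * ((1 + A) * SI) := by positivity
    have e11 : α * a ≤ α * SL := mul_le_mul_of_nonneg_left haSL hα.le
    have e12 : 0 ≤ a⁻¹ := by positivity
    rw [e4]
    linarith
  have := mul_nonpos_of_nonneg_of_nonpos hρ hYle
  linarith

/-- The second derivative of the test function along a line. -/
lemma hasDerivAt_test_line {n : ℕ} {A c : ℝ} (hc : 0 ≤ c) {k : Fin n} {a a₁ v : ℝ → ℝ}
    {p p₁ : Fin n → ℝ → ℝ} {a₂ : ℝ} {p₂ : Fin n → ℝ} (ha : ∀ s, 0 < a s) (hv : ∀ s, 0 < v s)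
    (hda : ∀ s, HasDerivAt a (a₁ s) s) (hda₁ : HasDerivAt a₁ a₂ 0)
    (hdv : ∀ s, HasDerivAt v (p k s) s)
    (hdp : ∀ i s, HasDerivAt (p i) (p₁ i s) s) (hdp₁ : ∀ i, HasDerivAt (p₁ i) (p₂ i) 0)
    (hmax : ∀ s, Real.log (a s) + (3 + A) / 2 * Real.log (1 + s ^ 2) - Real.log (1 + c * s ^ 2) -
      A * Real.log (v s) + (∑ i, p i s ^ 2 + (v s - s * p k s) ^ 2) / 2 ≤
      Real.log (a 0) - A * Real.log (v 0) + (∑ i, p i 0 ^ 2 + v 0 ^ 2) / 2) :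
    a₂ / a 0 - (a₁ 0 / a 0) ^ 2 + (3 + A - 2 * c) - A * (p₁ k 0 / v 0 - (p k 0 / v 0) ^ 2) +
      ∑ i, (p₁ i 0 ^ 2 + p i 0 * p₂ i) - v 0 * p₁ k 0 ≤ 0 := by
  have hs : ∀ s : ℝ, HasDerivAt (fun s : ℝ => 1 + s ^ 2) (2 * s) s := fun s => by
    simpa using (hasDerivAt_pow 2 s).const_add 1
  have hcs : ∀ s : ℝ, HasDerivAt (fun s : ℝ => 1 + c * s ^ 2) (c * (2 * s)) s := fun s => by
    simpa using ((hasDerivAt_pow 2 s).const_mul c).const_add 1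
  have hp1 : ∀ s : ℝ, 1 + s ^ 2 ≠ 0 := fun s => by positivity
  have hp2 : ∀ s : ℝ, 1 + c * s ^ 2 ≠ 0 := fun s => by positivity
  -- Since `v' = p k`, this derivative carries a factor `s`, so the square contributes only `-v p₁`
  -- to the second derivative at `0`.
  have hw : ∀ s, HasDerivAt (fun s => v s - s * p k s) (-(s * p₁ k s)) s := fun s => by
    refine ((hdv s).sub ((hasDerivAt_id s).mul (hdp k s))).congr_deriv ?_
    simp
  have h1 : ∀ s, HasDerivAt (fun s => Real.log (a s) + (3 + A) / 2 * Real.log (1 + s ^ 2) -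
      Real.log (1 + c * s ^ 2) - A * Real.log (v s) +
      (∑ i, p i s ^ 2 + (v s - s * p k s) ^ 2) / 2)
      (a₁ s / a s + (3 + A) / 2 * (2 * s / (1 + s ^ 2)) - c * (2 * s) / (1 + c * s ^ 2) -
        A * (p k s / v s) + (∑ i, 2 * (p i s * p₁ i s) +
          2 * ((v s - s * p k s) * -(s * p₁ k s))) / 2) s := by
    intro s
    have hsum : HasDerivAt (fun s => ∑ i, p i s ^ 2) (∑ i, 2 * (p i s * p₁ i s)) s := by
      refine HasDerivAt.fun_sum fun i _ => ?_
      refine ((hdp i s).pow 2).congr_deriv ?_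
      push_cast; ring
    have hw2 : HasDerivAt (fun s => (v s - s * p k s) ^ 2)
        (2 * ((v s - s * p k s) * -(s * p₁ k s))) s := by
      refine ((hw s).pow 2).congr_deriv ?_
      push_cast; ring
    exact (((((hda s).log (ha s).ne').add (((hs s).log (hp1 s)).const_mul _)).sub
      ((hcs s).log (hp2 s))).sub (((hdv s).log (hv s).ne').const_mul A)).add
      ((hsum.add hw2).div_const 2)
  have h2 : HasDerivAt (fun s => a₁ s / a s + (3 + A) / 2 * (2 * s / (1 + s ^ 2)) -
      c * (2 * s) / (1 + c * s ^ 2) - A * (p k s / v s) + (∑ i, 2 * (p i s * p₁ i s) +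
          2 * ((v s - s * p k s) * -(s * p₁ k s))) / 2)
      (a₂ / a 0 - (a₁ 0 / a 0) ^ 2 + (3 + A - 2 * c) - A * (p₁ k 0 / v 0 - (p k 0 / v 0) ^ 2) +
      ∑ i, (p₁ i 0 ^ 2 + p i 0 * p₂ i) - v 0 * p₁ k 0) 0 := by
    have hsum : HasDerivAt (fun s => ∑ i, 2 * (p i s * p₁ i s))
        (∑ i, 2 * (p₁ i 0 * p₁ i 0 + p i 0 * p₂ i)) 0 :=
      HasDerivAt.fun_sum fun i _ => ((hdp i 0).mul (hdp₁ i)).const_mul 2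
    have hw2 : HasDerivAt (fun s => 2 * ((v s - s * p k s) * -(s * p₁ k s)))
        (2 * (-(0 * p₁ k 0) * -(0 * p₁ k 0) + (v 0 - 0 * p k 0) *
          -(1 * p₁ k 0 + 0 * p₂ k))) 0 :=
      ((hw 0).mul (((hasDerivAt_id (0 : ℝ)).mul (hdp₁ k)).neg)).const_mul 2
    have hd : HasDerivAt (fun s : ℝ => 2 * s) 2 0 := by
      simpa using (hasDerivAt_id (0 : ℝ)).const_mul 2
    have h3 := (((((hda₁.div (hda 0) (ha 0).ne')).add
      ((hd.div (hs 0) (hp1 0)).const_mul ((3 + A) / 2))).sub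
      ((hd.const_mul c).div (hcs 0) (hp2 0))).sub
      (((hdp k 0).div (hdv 0) (hv 0).ne').const_mul A)).add ((hsum.add hw2).div_const 2)
    refine h3.congr_deriv ?_
    have e1 := (ha 0).ne'
    have e2 := (hv 0).ne'
    have e3 : ∑ i, 2 * (p₁ i 0 * p₁ i 0 + p i 0 * p₂ i) =
        2 * ∑ i, (p₁ i 0 ^ 2 + p i 0 * p₂ i) := by
      rw [Finset.mul_sum]
      exact Finset.sum_congr rfl fun i _ => by ring
    rw [e3]
    field_simp
    ring
  refine second_deriv_nonpos h1 h2 fun s => ?_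
  have := hmax s
  simpa using this

/-! ### The gradient bound -/

/-- The squared norm of the Euclidean gradient of the extension of degree one, that is, of the
position vector of the hypersurface with support function `S`. -/
def gradSq (S : USphere n → ℝ → ℝ) (p : Ambient n × ℝ) : ℝ :=
  ∑ j, Dx (EuclideanSpace.basisFun (Fin (n + 1)) ℝ j) (ext₁ S) p ^ 2

/-- Both sums are the squared norm of the vector representing the spatial differential. -/
lemma sum_sq_Dx_eq {ι κ : Type*} [Fintype ι] [Fintype κ] (b : OrthonormalBasis ι ℝ (Ambient n))
    (b' : OrthonormalBasis κ ℝ (Ambient n)) (f : Ambient n × ℝ → ℝ) (p : Ambient n × ℝ) :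
    ∑ i, Dx (b i) f p ^ 2 = ∑ i, Dx (b' i) f p ^ 2 := by
  set Λ : Ambient n →L[ℝ] ℝ := (fderivWithin ℝ f (Dom n) p).comp (ContinuousLinearMap.inl ℝ _ _)
  set y := (InnerProductSpace.toDual ℝ (Ambient n)).symm Λ with hy
  have hD : ∀ a, Dx a f p = inner ℝ y a := fun a => by
    rw [hy, InnerProductSpace.toDual_symm_apply]; rfl
  simp only [hD, b.sum_sq_inner_left, b'.sum_sq_inner_left]

lemma gradSq_eq {z : Ambient n} {e : Fin n → Ambient n} (he : IsFrame z e) (p : Ambient n × ℝ) :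
    gradSq S p = ∑ i, Dx (e i) (ext₁ S) p ^ 2 + Dx z (ext₁ S) p ^ 2 := by
  rw [gradSq, sum_sq_Dx_eq _ he.basis, Fin.sum_univ_succ, he.basis_zero, add_comm]
  simp only [he.basis_succ]

/-- First derivatives of a function of degree one have degree zero. -/
lemma IsNormalizedSolution.gradSq_toSphere (h : IsNormalizedSolution α S) {x : Ambient n}
    (hx : x ≠ 0) {t : ℝ} (ht : 0 ≤ t) :
    gradSq S ((toSphere x : Ambient n), t) = gradSq S (x, t) := by
  refine Finset.sum_congr rfl fun j _ => ?_
  have := (homog_ext₁ S).dx h.differentiableOn_ext₁ (EuclideanSpace.basisFun (Fin (n + 1)) ℝ j)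
    ‖x‖ (toSphere x) t (norm_pos_iff.2 hx) (coe_sphere_ne_zero _) ht
  rw [norm_smul_toSphere hx] at this
  rw [this]
  simp

lemma IsNormalizedSolution.continuousOn_gradSq (h : IsNormalizedSolution α S) :
    ContinuousOn (gradSq S) (Dom n) :=
  continuousOn_finsetSum _ fun _ _ => (h.differentiableOn_Dx _).continuousOn.pow 2

lemma IsFrame.line_ne_zero {z : Ambient n} {e : Fin n → Ambient n} (he : IsFrame z e) (k : Fin n)
    (s : ℝ) : z + s • e k ≠ 0 := by
  intro h0
  have : inner ℝ z (z + s • e k) = 1 := by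
    rw [inner_add_right, inner_smul_right, he.inner_base, real_inner_self_eq_norm_sq, he.norm_base]
    simp
  rw [h0] at this
  simp at this

lemma IsFrame.inner_line {z : Ambient n} {e : Fin n → Ambient n} (he : IsFrame z e) (k : Fin n)
    (s : ℝ) : inner ℝ z (z + s • e k) = 1 := by
  rw [inner_add_right, inner_smul_right, he.inner_base, real_inner_self_eq_norm_sq, he.norm_base]
  simp

lemma IsFrame.norm_line_sq {z : Ambient n} {e : Fin n → Ambient n} (he : IsFrame z e) (k : Fin n)
    (s : ℝ) : ‖z + s • e k‖ ^ 2 = 1 + s ^ 2 := by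
  rw [norm_add_sq_real, inner_smul_right, he.inner_base, he.norm_base, norm_smul,
    he.orthonormal.1 k]
  simp

lemma IsFrame.log_norm_line {z : Ambient n} {e : Fin n → Ambient n} (he : IsFrame z e) (k : Fin n)
    (s : ℝ) : Real.log ‖z + s • e k‖ = 1 / 2 * Real.log (1 + s ^ 2) := by
  rw [← he.norm_line_sq k s, Real.log_pow]
  push_cast
  ring

/-- On a sphere, the gradient is bounded by the support function. -/
lemma IsNormalizedSolution.gradSq_le (h : IsNormalizedSolution α S) {t M : ℝ} (ht : 0 ≤ t)
    (hS : ∀ z, 0 ≤ S z t ∧ S z t ≤ M) (z : USphere n) :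
    gradSq S ((z : Ambient n), t) ≤ M ^ 2 := by
  have hcont : Continuous fun z : USphere n => gradSq S ((z : Ambient n), t) :=
    h.continuousOn_gradSq.comp_continuous (by fun_prop)
      fun z => mem_Dom.2 ⟨coe_sphere_ne_zero z, ht⟩
  obtain ⟨z₀, -, hz₀⟩ := isCompact_univ.exists_isMaxOn ⟨z, mem_univ z⟩ hcont.continuousOn
  refine (hz₀ (mem_univ z)).trans ?_
  obtain ⟨e, lam, he, hlam, hdiag⟩ := h.exists_eigenframe z₀ ht
  have hz := coe_sphere_ne_zero z₀
  have hp : ((z₀ : Ambient n), t) ∈ Dom n := mem_Dom.2 ⟨hz, ht⟩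
  have hent : ∀ i j, Dx (e i) (Dx (e j) (ext₁ S)) ((z₀ : Ambient n), t) = diagonal lam i j :=
    fun i j => by rw [← hdiag]; rfl
  -- In an eigenframe the derivative of `|Du|²` along `e_k` is `2 λ_k u_k`, the radial term being
  -- zero. As `λ_k > 0`, the tangential gradient vanishes at a maximum, where `|Du|² = S²`.
  have hcrit : ∀ k, Dx (e k) (ext₁ S) ((z₀ : Ambient n), t) = 0 := by
    intro k
    have hl : ∀ a, HasDerivAt (fun s : ℝ => Dx a (ext₁ S) ((z₀ : Ambient n) + s • e k, t) ^ 2)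
        (2 * (Dx a (ext₁ S) ((z₀ : Ambient n), t) *
          Dx (e k) (Dx a (ext₁ S)) ((z₀ : Ambient n), t))) 0 := by
      intro a
      have := (hasDerivAt_line (h.differentiableOn_Dx a) z₀ (e k) (t := t) (s := 0)
        (by simpa using hz) ht).pow 2
      refine this.congr_deriv ?_
      push_cast
      simp only [zero_smul, add_zero]
      ring
    have hd := (HasDerivAt.fun_sum fun i (_ : i ∈ Finset.univ) => hl (e i)).add (hl z₀)
    have hmax : IsLocalMax (fun s : ℝ => gradSq S ((z₀ : Ambient n) + s • e k, t)) 0 := by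
      refine Filter.Eventually.of_forall fun s => ?_
      have := hz₀ (mem_univ (toSphere ((z₀ : Ambient n) + s • e k)))
      simp only [mem_ofPred_eq, h.gradSq_toSphere (he.line_ne_zero k s) ht] at this
      simpa using this
    have e1 : (fun s : ℝ => gradSq S ((z₀ : Ambient n) + s • e k, t)) =
        (fun s : ℝ => ∑ i, Dx (e i) (ext₁ S) ((z₀ : Ambient n) + s • e k, t) ^ 2) +
        fun s : ℝ => Dx z₀ (ext₁ S) ((z₀ : Ambient n) + s • e k, t) ^ 2 :=
      funext fun s => gradSq_eq he _
    rw [e1] at hmax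
    have h0 := hmax.hasDerivAt_eq_zero hd
    rw [Dx_comm h.contDiffOn_two hp (e k) z₀, h.Dx_Dx_radial hz ht,
      Finset.sum_eq_single k (fun i _ hi => by rw [hent, diagonal_apply_ne _ hi.symm]; ring)
      (by simp), hent, diagonal_apply_eq] at h0
    have hk := (hlam k).ne'
    simpa [hk] using h0
  change gradSq S ((z₀ : Ambient n), t) ≤ M ^ 2
  rw [gradSq_eq he]
  simp only [hcrit]
  rw [(homog_ext₁ S).euler h.differentiableOn_ext₁ hz ht, ext₁_coe]
  have := hS z₀
  simpa using pow_le_pow_left₀ this.1 this.2 2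

/-! ### The test function -/

/-- The test function of the maximum principle, at the unit tangent vector `a` at `x`. -/
def testFn (M : ℝ) (S : USphere n → ℝ → ℝ) (x a : Ambient n) (t : ℝ) : ℝ :=
  Real.log (Dx a (Dx a (ext₁ S)) (x, t)) - (2 + M ^ 2) * Real.log (ext₁ S (x, t)) +
    gradSq S (x, t) / 2

lemma IsNormalizedSolution.Dx_Dx_add_radial (h : IsNormalizedSolution α S) {x : Ambient n}
    (hx : x ≠ 0) {t : ℝ} (ht : 0 ≤ t) (a : Ambient n) (c : ℝ) :
    Dx (a + c • x) (Dx (a + c • x) (ext₁ S)) (x, t) = Dx a (Dx a (ext₁ S)) (x, t) := by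
  have hp : (x, t) ∈ Dom n := mem_Dom.2 ⟨hx, ht⟩
  rw [Dx_add, Dx_smul, h.Dx_Dx_radial hx ht, mul_zero, add_zero, Dx_comm h.contDiffOn_two hp,
    Dx_add, Dx_smul, h.Dx_Dx_radial hx ht, mul_zero, add_zero]

/-- Normalization of a vector `a` at `x` to a unit tangent vector at the projection of `x`. -/
lemma IsNormalizedSolution.exists_unit_tangent (h : IsNormalizedSolution α S) {x a : Ambient n}
    (hx : x ≠ 0) (ha : ‖a‖ = 1) (hd : 0 < ‖x‖ ^ 2 - inner ℝ x a ^ 2) {t : ℝ} (ht : 0 ≤ t) :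
    ∃ a' : Ambient n, ‖a'‖ = 1 ∧ inner ℝ (toSphere x : Ambient n) a' = 0 ∧
      Dx a' (Dx a' (ext₁ S)) ((toSphere x : Ambient n), t) =
        ‖x‖ ^ 3 / (‖x‖ ^ 2 - inner ℝ x a ^ 2) * Dx a (Dx a (ext₁ S)) (x, t) := by
  have hz := coe_sphere_ne_zero (toSphere x)
  have hzn := norm_coe_sphere (toSphere x)
  have hnx : 0 < ‖x‖ := norm_pos_iff.2 hx
  set z : Ambient n := (toSphere x : Ambient n) with hzdef
  have hp : (z, t) ∈ Dom n := mem_Dom.2 ⟨hz, ht⟩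
  -- Removing the radial part leaves the second derivative unchanged. Normalizing costs `‖b‖⁻² =
  -- |x|² / (|x|² - ⟪x, a⟫²)`, and moving from `x` to the sphere costs one more `|x|`.
  set b := a + (-inner ℝ z a) • z with hb
  have hza : inner ℝ z a = ‖x‖⁻¹ * inner ℝ x a := by
    rw [hzdef, coe_toSphere hx, real_inner_smul_left]
  have hbz : inner ℝ z b = 0 := by
    rw [hb, inner_add_right, inner_smul_right, real_inner_self_eq_norm_sq, hzn]; ring
  have hbn : ‖b‖ ^ 2 = (‖x‖ ^ 2 - inner ℝ x a ^ 2) / ‖x‖ ^ 2 := by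
    rw [hb, norm_add_sq_real, inner_smul_right, real_inner_comm z a, ha, norm_smul, hzn, mul_one,
      Real.norm_eq_abs, sq_abs, hza]
    field_simp
    ring
  have hb0 : 0 < ‖b‖ := by
    have : 0 < ‖b‖ ^ 2 := by rw [hbn]; positivity
    exact (norm_nonneg b).lt_of_ne' (sq_pos_iff.1 this)
  refine ⟨‖b‖⁻¹ • b, ?_, ?_, ?_⟩
  · rw [norm_smul, norm_inv, norm_norm, inv_mul_cancel₀ hb0.ne']
  · rw [inner_smul_right, hbz, mul_zero]
  · rw [Dx_smul, Dx_comm h.contDiffOn_two hp, Dx_smul, Dx_comm h.contDiffOn_two hp,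
      h.Dx_Dx_add_radial hz ht, h.Dx_Dx_smul hx ht, ← hzdef, ← mul_assoc, ← mul_assoc]
    congr 1
    rw [← mul_inv, ← sq, hbn]
    field_simp

/-! ### The maximum principle on gnomonic lines -/

namespace IsNormalizedSolution

lemma contDiffOn_D₁ (h : IsNormalizedSolution α S) (w : Ambient n × ℝ) :
    ContDiffOn ℝ (3 : ℕ) (D w (ext₁ S)) (Dom n) := contDiffOn_D h.contDiffOn_ext₁ (by norm_num) _

lemma contDiffOn_D₂ (h : IsNormalizedSolution α S) (w w' : Ambient n × ℝ) :
    ContDiffOn ℝ (2 : ℕ) (D w (D w' (ext₁ S))) (Dom n) :=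
  contDiffOn_D (h.contDiffOn_D₁ _) (by norm_num) _

lemma differentiableOn_D₁ (h : IsNormalizedSolution α S) (w : Ambient n × ℝ) :
    DifferentiableOn ℝ (D w (ext₁ S)) (Dom n) :=
  (h.contDiffOn_D₁ w).differentiableOn (by norm_num)

lemma differentiableOn_D₂ (h : IsNormalizedSolution α S) (w w' : Ambient n × ℝ) :
    DifferentiableOn ℝ (D w (D w' (ext₁ S))) (Dom n) :=
  (h.contDiffOn_D₂ w w').differentiableOn (by norm_num)

lemma differentiableOn_D₃ (h : IsNormalizedSolution α S) (w w' w'' : Ambient n × ℝ) :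
    DifferentiableOn ℝ (D w (D w' (D w'' (ext₁ S)))) (Dom n) :=
  (contDiffOn_D (l := 1) (h.contDiffOn_D₂ w' w'') (by norm_num) _).differentiableOn (by norm_num)

lemma D₃_comm_left (h : IsNormalizedSolution α S) {p : Ambient n × ℝ} (hp : p ∈ Dom n)
    (w w' w'' : Ambient n × ℝ) :
    D w (D w' (D w'' (ext₁ S))) p = D w' (D w (D w'' (ext₁ S))) p :=
  D_comm ((h.contDiffOn_D₁ _).of_le (by norm_num)) hp _ _

lemma D₃_comm_right (h : IsNormalizedSolution α S) {p : Ambient n × ℝ} (hp : p ∈ Dom n)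
    (w w' w'' : Ambient n × ℝ) :
    D w (D w' (D w'' (ext₁ S))) p = D w (D w'' (D w' (ext₁ S))) p :=
  D_congr (fun _ hq => D_comm h.contDiffOn_two hq _ _) hp _

lemma D₃_rotate (h : IsNormalizedSolution α S) {p : Ambient n × ℝ} (hp : p ∈ Dom n)
    (w w' w'' : Ambient n × ℝ) :
    D w (D w' (D w'' (ext₁ S))) p = D w' (D w'' (D w (ext₁ S))) p := by
  rw [h.D₃_comm_left hp, h.D₃_comm_right hp]

/-- Composed of swaps of adjacent derivatives; the outer swaps act on second derivatives, which must
be `C²`, hence the use of `C⁴`. -/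
lemma D₄_swap (h : IsNormalizedSolution α S) {p : Ambient n × ℝ} (hp : p ∈ Dom n)
    (w w' : Ambient n × ℝ) :
    D w (D w (D w' (D w' (ext₁ S)))) p = D w' (D w' (D w (D w (ext₁ S)))) p := by
  have h2 : ∀ w w', ContDiffOn ℝ 2 (D w (D w' (ext₁ S))) (Dom n) := fun w w' =>
    (h.contDiffOn_D₂ w w').of_le (by norm_num)
  have h1 : EqOn (D w (D w' (D w' (ext₁ S)))) (D w' (D w' (D w (ext₁ S)))) (Dom n) :=
    fun q hq => h.D₃_rotate hq _ _ _
  rw [D_congr h1 hp, D_comm (h2 _ _) hp]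
  exact D_congr (fun q hq => h.D₃_comm_left hq _ _ _) hp _

/-- The evolution equation in the gnomonic projection, on a line through the centre. -/
lemma D_time_line (h : IsNormalizedSolution α S) {z₀ : Ambient n} {e : Fin n → Ambient n}
    (he : IsFrame z₀ e) (k : Fin n) {t : ℝ} (ht : 0 ≤ t) (s : ℝ) :
    0 < (hessExt S e (z₀ + s • e k, t)).det ∧
    D (0, 1) (ext₁ S) (z₀ + s • e k, t) = ext₁ S (z₀ + s • e k, t) / (n + 1) -
      1 / eta α (fun y => S y t) * Real.exp ((1 - α * (n + 2)) / 2 * Real.log (1 + s ^ 2) -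
        α * Real.log (hessExt S e (z₀ + s • e k, t)).det) := by
  have hx := he.line_ne_zero k s
  set x := z₀ + s • e k with hxdef
  have hnx : 0 < ‖x‖ := norm_pos_iff.2 hx
  have hW := (h.posDef (toSphere x) t ht).det_pos
  have hdet := h.det_hessExt he (he.inner_line k s) ht
  rw [← hxdef] at hdet
  have hpos : 0 < (hessExt S e (x, t)).det := by rw [hdet]; positivity
  refine ⟨hpos, ?_⟩
  rw [h.D_time_ext₁ hx ht, ext₁_eq S hx]
  have heq := h.equation (toSphere x) t ht
  set W := (radiiMatrix (fun y => S y t) (toSphere x)).det with hWdef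
  set σ := derivWithin (S (toSphere x)) (Ici 0) t
  set ρ := 1 / eta α (fun y => S y t)
  have hσ : σ = S (toSphere x) t / (n + 1) - ρ * W ^ (-α) := by
    rw [← heq, Real.rpow_neg hW.le]
    have : W ^ α ≠ 0 := (Real.rpow_pos_of_pos hW α).ne'
    field_simp
    ring
  -- One factor `|x|` comes from the degree of `u_t`, and `|x|^(-α(n+2))` from `det_hessExt`;
  -- moreover `|x|² = 1 + s²`.
  have hexp : Real.exp ((1 - α * (n + 2)) / 2 * Real.log (1 + s ^ 2) -
      α * Real.log (hessExt S e (x, t)).det) = ‖x‖ * W ^ (-α) := by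
    rw [hdet, Real.log_mul (by positivity) hW.ne', Real.log_inv, Real.log_pow,
      ← he.norm_line_sq k s, ← hxdef, Real.log_pow, Real.rpow_def_of_pos hW]
    nth_rewrite 3 [← Real.exp_log hnx]
    rw [← Real.exp_add]
    congr 1
    push_cast
    ring
  rw [hexp, hσ]
  ring

/-- The test function on a line through the centre of a gnomonic projection. -/
lemma exists_testFn_line (h : IsNormalizedSolution α S) {z₀ : Ambient n} {e : Fin n → Ambient n}
    (he : IsFrame z₀ e) (k o : Fin n) {t : ℝ} (ht : 0 ≤ t) (hS : ∀ z, 0 < S z t) (M s : ℝ) :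
    ∃ (z : USphere n) (a : Ambient n), ‖a‖ = 1 ∧ inner ℝ (z : Ambient n) a = 0 ∧
      testFn M S z a t = Real.log (Dx (e o) (Dx (e o) (ext₁ S)) (z₀ + s • e k, t)) +
        (3 + (2 + M ^ 2)) / 2 * Real.log (1 + s ^ 2) -
        Real.log (1 + (if k = o then 0 else 1) * s ^ 2) -
        (2 + M ^ 2) * Real.log (ext₁ S (z₀ + s • e k, t)) +
        (∑ i, Dx (e i) (ext₁ S) (z₀ + s • e k, t) ^ 2 +
          (ext₁ S (z₀ + s • e k, t) - s * Dx (e k) (ext₁ S) (z₀ + s • e k, t)) ^ 2) / 2 := by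
  have hx := he.line_ne_zero k s
  have hn2 := he.norm_line_sq k s
  have hlog := he.log_norm_line k s
  have hin : inner ℝ (z₀ + s • e k) (e o) = if k = o then s else 0 := by
    rw [inner_add_left, real_inner_smul_left, he.inner_base,
      orthonormal_iff_ite.1 he.orthonormal]
    simp
  have hz₀x : Dx z₀ (ext₁ S) (z₀ + s • e k, t) =
      ext₁ S (z₀ + s • e k, t) - s * Dx (e k) (ext₁ S) (z₀ + s • e k, t) := by
    have h1 := (homog_ext₁ S).euler h.differentiableOn_ext₁ hx ht
    rw [Dx_add, Dx_smul] at h1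
    push_cast at h1
    linarith
  have hgrad := gradSq_eq (S := S) he (z₀ + s • e k, t)
  rw [hz₀x] at hgrad
  set x := z₀ + s • e k with hxdef
  have hnx : 0 < ‖x‖ := norm_pos_iff.2 hx
  -- If `k = o` the vector `e_o` points along the line and this is `1`, otherwise it is `1 + s²`;
  -- this is the coefficient `c` of `hasDerivAt_test_line`.
  have hd : ‖x‖ ^ 2 - inner ℝ x (e o) ^ 2 = 1 + (if k = o then 0 else 1) * s ^ 2 := by
    rw [hn2, hin]; split_ifs <;> ring
  have hd0 : 0 < 1 + (if k = o then 0 else 1) * s ^ 2 := by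
    split_ifs <;> positivity
  obtain ⟨a, ha, hza, hval⟩ := h.exists_unit_tangent hx (he.orthonormal.1 o) (by rwa [hd]) ht
  have hV : 0 < Dx (e o) (Dx (e o) (ext₁ S)) (x, t) := by
    refine h.Dx_Dx_pos hx ht fun c hc => ?_
    have h1 := congrArg (fun y => inner ℝ z₀ y) hc
    simp only [inner_smul_right, he.inner_base, hxdef, he.inner_line] at h1
    have hc0 : c = 0 := by linarith
    have h2 := he.orthonormal.1 o
    rw [hc, hc0] at h2
    simp at h2
  refine ⟨toSphere x, a, ha, hza, ?_⟩
  rw [testFn, hval, h.gradSq_toSphere hx ht, ext₁_coe, hd, hgrad, ext₁_eq S hx,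
    Real.log_mul (by positivity) hV.ne', Real.log_div (by positivity) hd0.ne', Real.log_pow,
    Real.log_mul hnx.ne' (hS _).ne', hlog]
  push_cast
  ring

/-- Each point of the line carries an admissible unit tangent vector, so the test function along it
is largest at `s = 0`. The constant is `3 + A - 2c` with `c = 0` for `k = o` and `c = 1` otherwise.
-/
lemma line_second_le (h : IsNormalizedSolution α S) {z₀ : Ambient n} {e : Fin n → Ambient n}
    (he : IsFrame z₀ e) {lam : Fin n → ℝ} {t : ℝ} (ht : 0 ≤ t) (hS : ∀ z, 0 < S z t)
    (hdiag : hessExt S e (z₀, t) = diagonal lam) (M : ℝ) (o : Fin n)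
    (hmax : ∀ (z : USphere n) (a : Ambient n), ‖a‖ = 1 → inner ℝ (z : Ambient n) a = 0 →
      testFn M S z a t ≤ testFn M S z₀ (e o) t) (k : Fin n) :
    Dx (e k) (Dx (e k) (Dx (e o) (Dx (e o) (ext₁ S)))) (z₀, t) / lam o -
      (Dx (e k) (Dx (e o) (Dx (e o) (ext₁ S))) (z₀, t) / lam o) ^ 2 +
      (1 + (2 + M ^ 2) + 2 * if k = o then 1 else 0) -
      (2 + M ^ 2) * (lam k / ext₁ S (z₀, t) -
        (Dx (e k) (ext₁ S) (z₀, t) / ext₁ S (z₀, t)) ^ 2) + lam k ^ 2 +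
      ∑ i, Dx (e i) (ext₁ S) (z₀, t) * Dx (e k) (Dx (e k) (Dx (e i) (ext₁ S))) (z₀, t) -
      ext₁ S (z₀, t) * lam k ≤ 0 := by
  have hz : z₀ ≠ 0 := by simpa using he.line_ne_zero k 0
  have hent : ∀ i j, Dx (e i) (Dx (e j) (ext₁ S)) (z₀, t) = diagonal lam i j :=
    fun i j => by rw [← hdiag]; rfl
  have hl : ∀ {f : Ambient n × ℝ → ℝ}, DifferentiableOn ℝ f (Dom n) → ∀ s : ℝ,
      HasDerivAt (fun s : ℝ => f (z₀ + s • e k, t)) (Dx (e k) f (z₀ + s • e k, t)) s :=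
    fun hf s => hasDerivAt_line hf _ _ (he.line_ne_zero k s) ht
  have hl0 : ∀ {f : Ambient n × ℝ → ℝ}, DifferentiableOn ℝ f (Dom n) →
      HasDerivAt (fun s : ℝ => f (z₀ + s • e k, t)) (Dx (e k) f (z₀, t)) 0 := fun hf => by
    simpa using hl hf 0
  have hVpos : ∀ s : ℝ, 0 < Dx (e o) (Dx (e o) (ext₁ S)) (z₀ + s • e k, t) := by
    intro s
    refine h.Dx_Dx_pos (he.line_ne_zero k s) ht fun c hc => ?_
    have h1 := congrArg (fun y => inner ℝ z₀ y) hc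
    simp only [inner_smul_right, he.inner_base, he.inner_line] at h1
    have hc0 : c = 0 := by linarith
    have h2 := he.orthonormal.1 o
    rw [hc, hc0] at h2
    simp at h2
  have key := hasDerivAt_test_line (A := 2 + M ^ 2) (c := if k = o then 0 else 1)
    (by split_ifs <;> norm_num) (k := k)
    (a := fun s => Dx (e o) (Dx (e o) (ext₁ S)) (z₀ + s • e k, t))
    (a₁ := fun s => Dx (e k) (Dx (e o) (Dx (e o) (ext₁ S))) (z₀ + s • e k, t))
    (v := fun s => ext₁ S (z₀ + s • e k, t))
    (p := fun i s => Dx (e i) (ext₁ S) (z₀ + s • e k, t))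
    (p₁ := fun i s => Dx (e k) (Dx (e i) (ext₁ S)) (z₀ + s • e k, t))
    hVpos
    (fun s => by
      rw [ext₁_eq S (he.line_ne_zero k s)]
      exact mul_pos (norm_pos_iff.2 (he.line_ne_zero k s)) (hS _))
    (hl (h.differentiableOn_D₂ _ _)) (hl0 (h.differentiableOn_D₃ _ _ _))
    (hl h.differentiableOn_ext₁) (fun i => hl (h.differentiableOn_D₁ _))
    (fun i => hl0 (h.differentiableOn_D₂ _ _)) (fun s => by
      obtain ⟨z, a, ha, hza, heq⟩ := h.exists_testFn_line he k o ht hS M s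
      rw [← heq]
      refine (hmax z a ha hza).trans_eq ?_
      rw [testFn, gradSq_eq he, (homog_ext₁ S).euler h.differentiableOn_ext₁ hz ht]
      simp)
  simp only [zero_smul, add_zero] at key
  refine le_of_eq_of_le ?_ key
  rw [Finset.sum_add_distrib]
  simp only [hent, diagonal_apply_eq]
  rw [Finset.sum_eq_single k (f := fun i => diagonal lam k i ^ 2)
    (fun i _ hi => by rw [diagonal_apply_ne _ hi.symm]; ring) (by simp), diagonal_apply_eq]
  split_ifs <;> ring

/-- The tangent space at `z₀` does not move, so `e_o` stays an admissible competitor at all earlier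
times. -/
lemma time_deriv_nonneg (h : IsNormalizedSolution α S) {z₀ : Ambient n} {e : Fin n → Ambient n}
    (he : IsFrame z₀ e) {t : ℝ} (ht : 0 < t) (M : ℝ) (o : Fin n)
    (hS : 0 < ext₁ S (z₀, t)) (hV : 0 < Dx (e o) (Dx (e o) (ext₁ S)) (z₀, t))
    (hmax : ∀ τ, 0 ≤ τ → τ ≤ t → testFn M S z₀ (e o) τ ≤ testFn M S z₀ (e o) t) :
    0 ≤ D (0, 1) (Dx (e o) (Dx (e o) (ext₁ S))) (z₀, t) / Dx (e o) (Dx (e o) (ext₁ S)) (z₀, t) -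
      (2 + M ^ 2) * (D (0, 1) (ext₁ S) (z₀, t) / ext₁ S (z₀, t)) +
      ∑ i, Dx (e i) (ext₁ S) (z₀, t) * D (0, 1) (Dx (e i) (ext₁ S)) (z₀, t) +
      ext₁ S (z₀, t) * D (0, 1) (ext₁ S) (z₀, t) := by
  have hz : z₀ ≠ 0 := by simpa using he.line_ne_zero o 0
  have hd : ∀ {f : Ambient n × ℝ → ℝ}, DifferentiableOn ℝ f (Dom n) →
      HasDerivAt (fun τ => f (z₀, τ)) (D (0, 1) f (z₀, t)) t := fun hf => hasDerivAt_time hf hz ht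
  have hsq : ∀ {f : Ambient n × ℝ → ℝ}, DifferentiableOn ℝ f (Dom n) →
      HasDerivAt (fun τ => f (z₀, τ) ^ 2) (2 * (f (z₀, t) * D (0, 1) f (z₀, t))) t := fun hf => by
    refine ((hd hf).pow 2).congr_deriv ?_
    push_cast; ring
  have h1 := (((hd (h.differentiableOn_D₂ (e o, 0) (e o, 0))).log hV.ne').sub
    (((hd h.differentiableOn_ext₁).log hS.ne').const_mul (2 + M ^ 2))).add
    (((HasDerivAt.fun_sum fun i (_ : i ∈ Finset.univ) =>
      hsq (h.differentiableOn_D₁ (e i, 0))).add (hsq h.differentiableOn_ext₁)).div_const 2)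
  have h2 := deriv_nonneg_of_left_max h1 ht fun τ hτ hτt => by
    have h3 := hmax τ hτ hτt
    rw [testFn, testFn, gradSq_eq he, gradSq_eq he,
      (homog_ext₁ S).euler h.differentiableOn_ext₁ hz hτ,
      (homog_ext₁ S).euler h.differentiableOn_ext₁ hz ht.le] at h3
    simpa using h3
  refine h2.trans_eq ?_
  rw [← Finset.mul_sum]
  ring

/-- At an interior maximum of the test function the largest principal radius is bounded. -/
lemma radius_lt (h : IsNormalizedSolution α S) (hα : 0 < α) {m M t : ℝ} (hm : 0 < m) (ht : 0 < t)
    (hS : ∀ z, m ≤ S z t ∧ S z t ≤ M) {z₀ : USphere n} {e : Fin n → Ambient n}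
    (he : IsFrame (z₀ : Ambient n) e) {lam : Fin n → ℝ} (hlam : ∀ i, 0 < lam i)
    (hdiag : hessExt S e (z₀, t) = diagonal lam) (o : Fin n)
    (hmax : ∀ (z : USphere n) (a : Ambient n) (τ : ℝ), ‖a‖ = 1 → inner ℝ (z : Ambient n) a = 0 →
      0 ≤ τ → τ ≤ t → testFn M S z a τ ≤ testFn M S z₀ (e o) t) :
    lam o < radiusBound n α m M := by
  have hz := coe_sphere_ne_zero z₀
  have hp : ((z₀ : Ambient n), t) ∈ Dom n := mem_Dom.2 ⟨hz, ht.le⟩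
  have hent : ∀ i j, Dx (e i) (Dx (e j) (ext₁ S)) ((z₀ : Ambient n), t) = diagonal lam i j :=
    fun i j => by rw [← hdiag]; rfl
  have hSpos : ∀ z, 0 < S z t := fun z => hm.trans_le (hS z).1
  have hl : ∀ (k : Fin n) {f : Ambient n × ℝ → ℝ}, DifferentiableOn ℝ f (Dom n) → ∀ s : ℝ,
      HasDerivAt (fun s : ℝ => f (z₀ + s • e k, t)) (Dx (e k) f (z₀ + s • e k, t)) s :=
    fun k _ hf s => hasDerivAt_line hf _ _ (he.line_ne_zero k s) ht.le
  have hl0 : ∀ (k : Fin n) {f : Ambient n × ℝ → ℝ}, DifferentiableOn ℝ f (Dom n) →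
      HasDerivAt (fun s : ℝ => f (z₀ + s • e k, t)) (Dx (e k) f (z₀, t)) 0 := fun k _ hf => by
    simpa using hl k hf 0
  set γ : ℝ := (1 - α * (n + 2)) / 2 with hγ
  set ρ := 1 / eta α (fun y => S y t) with hρ
  -- The sign is all that is used of `η`.
  have hρ0 : 0 ≤ ρ := by
    refine one_div_nonneg.2 (MeasureTheory.integral_nonneg fun z => ?_)
    have : 0 ≤ gaussCurv (fun y => S y t) z :=
      inv_nonneg.2 (h.posDef z t ht.le).det_pos.le
    exact one_div_nonneg.2 (Real.rpow_nonneg this _)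
  -- Logarithmic derivative of the speed factor `E` along the `k`-th line.
  set ℓ₁ : Fin n → ℝ → ℝ := fun k s => γ * (2 * s / (1 + s ^ 2)) -
    α * trace ((hessExt S e (z₀ + s • e k, t))⁻¹ *
      Matrix.of fun i j => Dx (e k) (Dx (e i) (Dx (e j) (ext₁ S))) (z₀ + s • e k, t)) with hℓ₁
  set E : Fin n → ℝ → ℝ := fun k s => Real.exp (γ * Real.log (1 + s ^ 2) -
        α * Real.log (hessExt S e (z₀ + s • e k, t)).det) with hE
  have hM : ∀ k s i j, HasDerivAt (fun s : ℝ => hessExt S e (z₀ + s • e k, t) i j)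
      (Matrix.of (fun i j => Dx (e k) (Dx (e i) (Dx (e j) (ext₁ S))) (z₀ + s • e k, t)) i j) s :=
    fun k s i j => hl k (h.differentiableOn_D₂ _ _) s
  have hs2 : ∀ s : ℝ, HasDerivAt (fun s : ℝ => 1 + s ^ 2) (2 * s) s := fun s => by
    simpa using (hasDerivAt_pow 2 s).const_add 1
  have hp1 : ∀ s : ℝ, 1 + s ^ 2 ≠ 0 := fun s => by positivity
  have hEd : ∀ k s, HasDerivAt (E k) (E k s * ℓ₁ k s) s := fun k s =>
    ((((hs2 s).log (hp1 s)).const_mul γ).sub ((hasDerivAt_log_det (hM k s)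
      (h.D_time_line he k ht.le s).1.ne').const_mul α)).exp
  have heq : ∀ k, (fun s : ℝ => D (0, 1) (ext₁ S) (z₀ + s • e k, t)) =
      fun s => ext₁ S (z₀ + s • e k, t) / (n + 1) - ρ * E k s :=
    fun k => funext fun s => (h.D_time_line he k ht.le s).2
  have heq1 : ∀ k s, Dx (e k) (D (0, 1) (ext₁ S)) (z₀ + s • e k, t) =
      Dx (e k) (ext₁ S) (z₀ + s • e k, t) / (n + 1) - ρ * (E k s * ℓ₁ k s) := by
    intro k s
    have h1 := hl k (h.differentiableOn_D₁ (0, 1)) s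
    rw [heq k] at h1
    exact h1.unique (((hl k h.differentiableOn_ext₁ s).div_const _).sub ((hEd k s).const_mul ρ))
  have hℓd : HasDerivAt (ℓ₁ o) (2 * γ - α *
      (∑ j, (lam j)⁻¹ * Dx (e j) (Dx (e j) (Dx (e o) (Dx (e o) (ext₁ S)))) (z₀, t) -
        ∑ i, ∑ j, (lam i)⁻¹ * (lam j)⁻¹ * (Dx (e o) (Dx (e i) (Dx (e j) (ext₁ S))) (z₀, t) *
          Dx (e o) (Dx (e i) (Dx (e j) (ext₁ S))) (z₀, t)))) 0 := by
    have hd : HasDerivAt (fun s : ℝ => 2 * s) 2 0 := by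
      simpa using (hasDerivAt_id (0 : ℝ)).const_mul 2
    have h1 := hasDerivAt_trace_inv_mul (hM o 0)
      (M₁ := fun s => Matrix.of
        (fun i j => Dx (e o) (Dx (e i) (Dx (e j) (ext₁ S))) (z₀ + s • e o, t)))
      (M₂ := Matrix.of (fun i j => Dx (e o) (Dx (e o) (Dx (e i) (Dx (e j) (ext₁ S)))) (z₀, t)))
      (fun i j => hl0 o (h.differentiableOn_D₃ _ _ _)) (fun i => (hlam i).ne')
      (by simpa using hdiag)
    refine (((hd.div (hs2 0) (hp1 0)).const_mul γ).sub (h1.const_mul α)).congr_deriv ?_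
    simp only [of_apply, zero_smul, add_zero]
    have e1 : ∀ j, Dx (e o) (Dx (e o) (Dx (e j) (Dx (e j) (ext₁ S)))) ((z₀ : Ambient n), t) =
        Dx (e j) (Dx (e j) (Dx (e o) (Dx (e o) (ext₁ S)))) (z₀, t) := fun j => h.D₄_swap hp _ _
    have e2 : ∀ i j, Dx (e o) (Dx (e i) (Dx (e j) (ext₁ S))) ((z₀ : Ambient n), t) *
        Dx (e o) (Dx (e j) (Dx (e i) (ext₁ S))) (z₀, t) =
        Dx (e o) (Dx (e i) (Dx (e j) (ext₁ S))) (z₀, t) *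
          Dx (e o) (Dx (e i) (Dx (e j) (ext₁ S))) (z₀, t) := fun i j => by
      congr 1
      exact h.D₃_comm_right hp _ _ _
    simp only [e1, e2]
    ring
  have hE0 : ∀ k, E k 0 = E o 0 := fun k => by simp [hE]
  -- Differentiating the exponential twice gives `E (ℓ₁² + ℓ₁')`; the square has a favourable sign
  -- and is dropped in `lt_radiusBound`.
  have heq2 : Dx (e o) (Dx (e o) (D (0, 1) (ext₁ S))) (z₀, t) =
      lam o / (n + 1) - ρ * E o 0 * (ℓ₁ o 0 ^ 2 + (2 * γ - α *
      (∑ j, (lam j)⁻¹ * Dx (e j) (Dx (e j) (Dx (e o) (Dx (e o) (ext₁ S)))) (z₀, t) -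
        ∑ i, ∑ j, (lam i)⁻¹ * (lam j)⁻¹ * (Dx (e o) (Dx (e i) (Dx (e j) (ext₁ S))) (z₀, t) *
          Dx (e o) (Dx (e i) (Dx (e j) (ext₁ S))) (z₀, t))))) := by
    have h1 := hl0 o (h.differentiableOn_D₂ (e o, 0) (0, 1))
    rw [show (fun s : ℝ => D (e o, 0) (D (0, 1) (ext₁ S)) (z₀ + s • e o, t)) = _ from
      funext (heq1 o)] at h1
    have h2 := ((hl0 o (h.differentiableOn_D₁ (e o, 0))).div_const ((n : ℝ) + 1)).sub
      (((hEd o 0).mul hℓd).const_mul ρ)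
    rw [h1.unique h2, hent, diagonal_apply_eq]
    ring
  have hℓ0 : ∀ k, ℓ₁ k 0 =
      -(α * ∑ j, (lam j)⁻¹ * Dx (e j) (Dx (e j) (Dx (e k) (ext₁ S))) (z₀, t)) := by
    intro k
    have h1 := trace_inv_mul_diagonal (M := hessExt S e (z₀, t))
      (M₁ := Matrix.of fun i j => Dx (e k) (Dx (e i) (Dx (e j) (ext₁ S))) (z₀, t))
      (fun i => (hlam i).ne') hdiag
    simp only [hℓ₁, zero_smul, add_zero, h1, of_apply]
    have e1 : ∀ j, Dx (e k) (Dx (e j) (Dx (e j) (ext₁ S))) ((z₀ : Ambient n), t) =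
        Dx (e j) (Dx (e j) (Dx (e k) (ext₁ S))) (z₀, t) := fun j => h.D₃_rotate hp _ _ _
    simp only [e1]
    ring
  have hmv : m ≤ ext₁ S ((z₀ : Ambient n), t) := by rw [ext₁_coe]; exact (hS z₀).1
  have hvM : ext₁ S ((z₀ : Ambient n), t) ≤ M := by rw [ext₁_coe]; exact (hS z₀).2
  refine lt_radiusBound (γ := γ) (v := ext₁ S ((z₀ : Ambient n), t)) (ρ := ρ * E o 0)
    (q := ℓ₁ o 0) (g := fun i => Dx (e i) (ext₁ S) (z₀, t))
    (B := fun k => Dx (e k) (Dx (e k) (Dx (e o) (Dx (e o) (ext₁ S)))) (z₀, t))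
    (C := fun k => Dx (e k) (Dx (e o) (Dx (e o) (ext₁ S))) (z₀, t))
    (N := fun k i => Dx (e k) (Dx (e k) (Dx (e i) (ext₁ S))) (z₀, t))
    (T := fun i j => Dx (e o) (Dx (e i) (Dx (e j) (ext₁ S))) (z₀, t))
    hα hm (by rw [hγ]; ring) hmv hvM (mul_nonneg hρ0 (Real.exp_pos _).le) hlam
    (fun k => h.D₃_comm_left hp _ _ _) ?_
    (h.line_second_le he ht.le hSpos hdiag M o fun z a ha hza => hmax z a t ha hza ht.le le_rfl) ?_
  · have h1 := h.gradSq_le ht.le (fun z => ⟨(hSpos z).le, (hS z).2⟩) z₀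
    rw [gradSq_eq he, (homog_ext₁ S).euler h.differentiableOn_ext₁ hz ht.le] at h1
    simpa using h1
  · have h1 := h.time_deriv_nonneg he ht M o (hm.trans_le hmv)
      (by rw [hent, diagonal_apply_eq]; exact hlam o)
      (fun τ hτ hτt => hmax z₀ (e o) τ (he.orthonormal.1 o) (he.inner_base o) hτ hτt)
    have e1 : D (0, 1) (Dx (e o) (Dx (e o) (ext₁ S))) ((z₀ : Ambient n), t) =
        Dx (e o) (Dx (e o) (D (0, 1) (ext₁ S))) (z₀, t) := h.D₃_rotate hp _ _ _
    have e2 : ∀ i, D (0, 1) (Dx (e i) (ext₁ S)) ((z₀ : Ambient n), t) =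
        Dx (e i) (ext₁ S) (z₀, t) / (n + 1) - ρ * E o 0 *
          -(α * ∑ j, (lam j)⁻¹ * Dx (e j) (Dx (e j) (Dx (e i) (ext₁ S))) (z₀, t)) := by
      intro i
      have h2 := heq1 i 0
      simp only [zero_smul, add_zero] at h2
      rw [D_comm h.contDiffOn_two hp, ← hℓ0 i, ← hE0 i]
      refine h2.trans ?_
      ring
    have e3 : D (0, 1) (ext₁ S) ((z₀ : Ambient n), t) =
        ext₁ S (z₀, t) / (n + 1) - ρ * E o 0 := by
      simpa using congrFun (heq o) 0
    rw [e1, heq2, e3, hent, diagonal_apply_eq] at h1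
    simp only [e2] at h1
    exact h1

end IsNormalizedSolution

/-! ### From the maximum to the Hessian bound -/

/-- The bound for the largest principal radius at the maximum of the test function, including the
initial time. -/
def maxRadiusBound (n : ℕ) (α m M H : ℝ) : ℝ := max 1 (max (radiusBound n α m M) (H + M))

/-- The bound for the principal radii. -/
def radiiBound (n : ℕ) (α m M H : ℝ) : ℝ :=
  Real.exp (Real.log (maxRadiusBound n α m M H) - (2 + M ^ 2) * Real.log m + M ^ 2 / 2 +
    (2 + M ^ 2) * Real.log M)

namespace IsNormalizedSolution

lemma Dx_Dx_tangent_pos (h : IsNormalizedSolution α S) {x a : Ambient n} (hx : x ≠ 0)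
    (hxa : inner ℝ x a = 0) (ha : a ≠ 0) {t : ℝ} (ht : 0 ≤ t) :
    0 < Dx a (Dx a (ext₁ S)) (x, t) := by
  refine h.Dx_Dx_pos hx ht fun c hc => ha ?_
  have h1 : inner ℝ a a = 0 := by
    nth_rewrite 1 [hc]
    rw [real_inner_smul_left, hxa, mul_zero]
  exact inner_self_eq_zero.1 h1

/-- For `a = ∑ c_i e_i` of unit length `∑ (c_i c_j)² = 1`, so Cauchy–Schwarz bounds `∇̄²S(a, a)` by
the Hessian norm. -/
lemma initial_le (h : IsNormalizedSolution α S) {M H : ℝ} (z : USphere n)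
    (hH : hessNorm (fun y => S y 0) z ≤ H) (hM : S z 0 ≤ M) {a : Ambient n} (ha : ‖a‖ = 1)
    (hza : inner ℝ (z : Ambient n) a = 0) :
    Dx a (Dx a (ext₁ S)) ((z : Ambient n), 0) ≤ H + M := by
  have hf := isFrame_frame z
  have hp : ((z : Ambient n), (0 : ℝ)) ∈ Dom n := mem_Dom.2 ⟨coe_sphere_ne_zero z, le_rfl⟩
  rw [h.Dx_Dx_ext₁ z le_rfl hza hza, real_inner_self_eq_norm_sq, ha]
  have hexp := hf.sum_smul a
  rw [hza, zero_smul, zero_add] at hexp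
  have hnorm := hf.sum_inner_mul_inner a a
  rw [hza, mul_zero, zero_add, real_inner_self_eq_norm_sq, ha] at hnorm
  set c : Fin n → ℝ := fun i => inner ℝ (frame z i) a with hc
  have h1 : sphHess (fun y => S y 0) z a a =
      ∑ p : Fin n × Fin n, c p.1 * c p.2 * hessMatrix (fun y => S y 0) z p.1 p.2 := by
    rw [h.sphHess_eq z le_rfl, Fintype.sum_prod_type]
    conv_lhs => rw [← hexp]
    rw [Dx_Dx_sum (h.contDiffOn_ext₀.of_le (by norm_num)) hp]
    refine Finset.sum_congr rfl fun i _ => Finset.sum_congr rfl fun j _ => ?_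
    rw [hessMatrix, of_apply, h.sphHess_eq z le_rfl]
  have h2 := Real.sum_mul_le_sqrt_mul_sqrt Finset.univ
    (fun p : Fin n × Fin n => c p.1 * c p.2)
    (fun p => hessMatrix (fun y => S y 0) z p.1 p.2)
  have h3 : ∑ p : Fin n × Fin n, (c p.1 * c p.2) ^ 2 = 1 := by
    have : ∑ i, c i ^ 2 = 1 := by
      have e : ∑ i, c i ^ 2 = ∑ i, c i * c i := Finset.sum_congr rfl fun i _ => sq _
      rw [e, hnorm]; norm_num
    simp only [mul_pow, Fintype.sum_prod_type, ← Finset.mul_sum, ← Finset.sum_mul, this, one_mul]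
  rw [h3, Real.sqrt_one, one_mul, Fintype.sum_prod_type (f := fun p : Fin n × Fin n =>
    hessMatrix (fun y => S y 0) z p.1 p.2 ^ 2), ← h1] at h2
  have h4 : hessNorm (fun y => S y 0) z =
    Real.sqrt (∑ i, ∑ j, hessMatrix (fun y => S y 0) z i j ^ 2) := rfl
  rw [← h4] at h2
  linarith

/-- The direction varies too; expanding it in the standard basis leaves finitely many continuous
second derivatives. -/
lemma continuousOn_Dx_Dx (h : IsNormalizedSolution α S) :
    ContinuousOn (fun q : Ambient n × Ambient n × ℝ => Dx q.2.1 (Dx q.2.1 (ext₁ S)) (q.1, q.2.2))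
      {q | (q.1, q.2.2) ∈ Dom n} := by
  let b := EuclideanSpace.basisFun (Fin (n + 1)) ℝ
  have h1 : ContinuousOn (fun q : Ambient n × Ambient n × ℝ =>
      ∑ i, ∑ j, q.2.1 i * q.2.1 j * Dx (b i) (Dx (b j) (ext₁ S)) (q.1, q.2.2))
      {q | (q.1, q.2.2) ∈ Dom n} := by
    refine continuousOn_finsetSum _ fun i _ => continuousOn_finsetSum _ fun j _ => ?_
    refine ContinuousOn.mul (Continuous.continuousOn (by fun_prop)) ?_
    exact (h.differentiableOn_D₂ (b i, 0) (b j, 0)).continuousOn.comp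
      (Continuous.continuousOn (by fun_prop)) (fun q hq => hq)
  refine h1.congr fun q hq => ?_
  have h2 : q.2.1 = ∑ i, q.2.1 i • b i := by
    have := b.sum_repr q.2.1
    simpa [b] using this.symm
  have h3 := Dx_Dx_sum h.contDiffOn_two hq Finset.univ Finset.univ (fun i => q.2.1 i)
    (fun i => q.2.1 i) b b
  rw [← h2] at h3
  exact h3

/-- The unit tangent bundle times `[0, τ₁]` is compact, and both logarithms have positive arguments
on it. -/
lemma exists_isMaxOn_testFn (h : IsNormalizedSolution α S) {τ₁ M : ℝ}
    (hS : ∀ z τ, 0 ≤ τ → τ ≤ τ₁ → 0 < S z τ) (z : USphere n) {a : Ambient n} (ha : ‖a‖ = 1)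
    (hza : inner ℝ (z : Ambient n) a = 0) (hτ₁ : 0 ≤ τ₁) :
    ∃ (z₀ : USphere n) (a₀ : Ambient n) (t₀ : ℝ), ‖a₀‖ = 1 ∧ inner ℝ (z₀ : Ambient n) a₀ = 0 ∧
      0 ≤ t₀ ∧ t₀ ≤ τ₁ ∧ ∀ (z : USphere n) (a : Ambient n) (τ : ℝ), ‖a‖ = 1 →
        inner ℝ (z : Ambient n) a = 0 → 0 ≤ τ → τ ≤ τ₁ →
          testFn M S z a τ ≤ testFn M S z₀ a₀ t₀ := by
  let K : Set (Ambient n × Ambient n × ℝ) :=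
    (Metric.sphere 0 1 ×ˢ Metric.sphere 0 1 ×ˢ Icc 0 τ₁) ∩ {q | inner ℝ q.1 q.2.1 = 0}
  have hK : IsCompact K :=
    ((isCompact_sphere _ _).prod ((isCompact_sphere _ _).prod isCompact_Icc)).inter_right
      (isClosed_eq (by fun_prop) continuous_const)
  have hmem : ∀ (z : USphere n) (a : Ambient n) (τ : ℝ), ‖a‖ = 1 →
      inner ℝ (z : Ambient n) a = 0 → 0 ≤ τ → τ ≤ τ₁ → ((z : Ambient n), a, τ) ∈ K :=
    fun z a τ ha hza h0 h1 => ⟨⟨z.2, by simpa using ha, h0, h1⟩, hza⟩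
  have hKx : ∀ q ∈ K, q.1 ≠ 0 := fun q hq => ne_zero_of_mem_unit_sphere ⟨q.1, hq.1.1⟩
  have hdom : ∀ q ∈ K, (q.1, q.2.2) ∈ Dom n := fun q hq => ⟨hKx q hq, hq.1.2.2.1⟩
  have hproj : ContinuousOn (fun q : Ambient n × Ambient n × ℝ => (q.1, q.2.2)) K :=
    Continuous.continuousOn (by fun_prop)
  have hcont : ContinuousOn (fun q : Ambient n × Ambient n × ℝ => testFn M S q.1 q.2.1 q.2.2) K := by
    refine ((ContinuousOn.log (h.continuousOn_Dx_Dx.mono hdom) fun q hq => ?_).sub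
      (continuousOn_const.mul (ContinuousOn.log
        (h.differentiableOn_ext₁.continuousOn.comp hproj hdom) fun q hq => ?_))).add
      ((h.continuousOn_gradSq.comp hproj hdom).div_const 2)
    · have ha0 : q.2.1 ≠ 0 := ne_zero_of_mem_unit_sphere ⟨q.2.1, hq.1.2.1⟩
      exact (h.Dx_Dx_tangent_pos (hKx q hq) hq.2 ha0 hq.1.2.2.1).ne'
    · have h1 := hS (toSphere q.1) q.2.2 hq.1.2.2.1 hq.1.2.2.2
      have h2 := norm_pos_iff.2 (hKx q hq)
      rw [Function.comp_apply, ext₁_eq S (hKx q hq)]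
      exact (mul_pos h2 h1).ne'
  obtain ⟨q, hq, hmax⟩ := hK.exists_isMaxOn ⟨_, hmem z a τ₁ ha hza hτ₁ le_rfl⟩ hcont
  exact ⟨⟨q.1, hq.1.1⟩, q.2.1, q.2.2, by simpa using hq.1.2.1, hq.2, hq.1.2.2.1, hq.1.2.2.2,
    fun z a τ ha hza h0 h1 => hmax (hmem z a τ ha hza h0 h1)⟩

/-- The principal radii are bounded. -/
lemma Dx_Dx_le_radiiBound (h : IsNormalizedSolution α S) (hn : 1 ≤ n) (hα : 0 < α)
    {m M H τ₁ : ℝ} (hm : 0 < m) (hH : ∀ z, hessNorm (fun y => S y 0) z ≤ H) (hτ₁ : 0 ≤ τ₁)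
    (hS : ∀ z τ, 0 ≤ τ → τ ≤ τ₁ → m ≤ S z τ ∧ S z τ ≤ M) (z : USphere n) {a : Ambient n}
    (ha : ‖a‖ = 1) (hza : inner ℝ (z : Ambient n) a = 0) :
    Dx a (Dx a (ext₁ S)) ((z : Ambient n), τ₁) ≤ radiiBound n α m M H := by
  have hSpos : ∀ z τ, 0 ≤ τ → τ ≤ τ₁ → 0 < S z τ := fun z τ h0 h1 => hm.trans_le (hS z τ h0 h1).1
  obtain ⟨z₀, a₀, t₀, ha₀, hza₀, ht₀, ht₀', hmax⟩ :=
    h.exists_isMaxOn_testFn (M := M) hSpos z ha hza hτ₁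
  obtain ⟨e, lam, he, hlam, hdiag⟩ := h.exists_eigenframe z₀ ht₀
  have : Nonempty (Fin n) := ⟨⟨0, hn⟩⟩
  obtain ⟨o, ho⟩ := Finite.exists_max lam
  have heo : Dx (e o) (Dx (e o) (ext₁ S)) ((z₀ : Ambient n), t₀) = lam o := by
    have h1 : hessExt S e (z₀, t₀) o o = lam o := by rw [hdiag, diagonal_apply_eq]
    exact h1
  have ha₀le : Dx a₀ (Dx a₀ (ext₁ S)) ((z₀ : Ambient n), t₀) ≤ lam o := by
    rw [h.Dx_Dx_eq_sum he ht₀, hdiag]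
    have hnorm := he.sum_inner_mul_inner a₀ a₀
    rw [hza₀, mul_zero, zero_add, real_inner_self_eq_norm_sq, ha₀] at hnorm
    calc _ = ∑ k, inner ℝ (e k) a₀ * inner ℝ (e k) a₀ * lam k := by
          refine Finset.sum_congr rfl fun k _ => ?_
          rw [Finset.sum_eq_single k
            (fun l _ hl => by rw [diagonal_apply_ne _ hl.symm, mul_zero]) (by simp),
            diagonal_apply_eq]
      _ ≤ ∑ k, inner ℝ (e k) a₀ * inner ℝ (e k) a₀ * lam o :=
          Finset.sum_le_sum fun k _ => mul_le_mul_of_nonneg_left (ho k) (mul_self_nonneg _)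
      _ = lam o := by rw [← Finset.sum_mul, hnorm]; ring
  have ha₀pos := h.Dx_Dx_tangent_pos (coe_sphere_ne_zero z₀) hza₀
    (norm_pos_iff.1 (by rw [ha₀]; norm_num)) ht₀
  -- Only the Hessian term depends on the vector, so the maximizing `a₀` may be replaced by the
  -- eigenvector of the largest radius.
  have hmax' : ∀ (z : USphere n) (a : Ambient n) (τ : ℝ), ‖a‖ = 1 →
      inner ℝ (z : Ambient n) a = 0 → 0 ≤ τ → τ ≤ τ₁ →
        testFn M S z a τ ≤ testFn M S z₀ (e o) t₀ := by
    intro z a τ ha hza h0 h1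
    refine (hmax z a τ ha hza h0 h1).trans ?_
    have := Real.log_le_log ha₀pos (ha₀le.trans_eq heo.symm)
    rw [testFn, testFn]
    linarith
  have hR1 : 0 < maxRadiusBound n α m M H := lt_of_lt_of_le one_pos (le_max_left _ _)
  have hlamle : lam o ≤ maxRadiusBound n α m M H := by
    refine le_trans ?_ (le_max_right _ _)
    -- A maximum at time zero is controlled by the initial data; at a later `t₀` the maximum
    -- principle applies on `[0, t₀]`.
    rcases ht₀.eq_or_lt with h0 | h0
    · subst h0
      rw [← heo]
      exact (h.initial_le z₀ (hH z₀) (hS z₀ 0 le_rfl hτ₁).2 (he.orthonormal.1 o)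
        (he.inner_base o)).trans (le_max_right _ _)
    · exact (h.radius_lt hα hm h0 (fun z => hS z t₀ ht₀ ht₀') he hlam hdiag o
        fun z a τ ha hza h1 h2 => hmax' z a τ ha hza h1 (h2.trans ht₀')).le.trans (le_max_left _ _)
  have hpos := h.Dx_Dx_tangent_pos (coe_sphere_ne_zero z) hza
    (norm_pos_iff.1 (by rw [ha]; norm_num)) hτ₁
  rw [radiiBound, ← Real.log_le_iff_le_exp hpos]
  -- In this comparison the gradient term is at least `0` on the left and at most `M²/2` on the
  -- right.
  have h1 := hmax' z a τ₁ ha hza hτ₁ le_rfl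
  rw [testFn, testFn, heo, ext₁_coe, ext₁_coe] at h1
  have h2 := h.gradSq_le ht₀ (fun z => ⟨(hSpos z t₀ ht₀ ht₀').le, (hS z t₀ ht₀ ht₀').2⟩) z₀
  have h3 : 0 ≤ gradSq S ((z : Ambient n), τ₁) := Finset.sum_nonneg fun _ _ => sq_nonneg _
  have h4 := Real.log_le_log (hlam o) hlamle
  have hA : 0 ≤ 2 + M ^ 2 := by positivity
  have h5 := mul_le_mul_of_nonneg_left (Real.log_le_log hm (hS z₀ t₀ ht₀ ht₀').1) hA
  have h6 := mul_le_mul_of_nonneg_left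
    (Real.log_le_log (hSpos z τ₁ hτ₁ le_rfl) (hS z τ₁ hτ₁ le_rfl).2) hA
  linarith

/-- A bound for the principal radii bounds the Hessian of the support function. -/
lemma hessNorm_le (h : IsNormalizedSolution α S) {R M t : ℝ} (ht : 0 ≤ t) (z : USphere n)
    (hM : |S z t| ≤ M) (hR0 : 0 ≤ R) (hR : ∀ a : Ambient n, ‖a‖ = 1 →
      inner ℝ (z : Ambient n) a = 0 → Dx a (Dx a (ext₁ S)) ((z : Ambient n), t) ≤ R) :
    hessNorm (fun y => S y t) z ≤ n * (R + M) := by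
  have hf := isFrame_frame z
  have hz := coe_sphere_ne_zero z
  have hp : ((z : Ambient n), t) ∈ Dom n := mem_Dom.2 ⟨hz, ht⟩
  have hM0 : 0 ≤ M := (abs_nonneg _).trans hM
  set Q : Fin n → Fin n → ℝ := fun i j =>
    Dx (frame z i) (Dx (frame z j) (ext₁ S)) ((z : Ambient n), t) with hQ
  have hQR : ∀ i, Q i i ≤ R := fun i => hR _ (hf.orthonormal.1 i) (hf.inner_base i)
  -- Positivity on `e_i + c e_j`; `c = ±1` bounds off-diagonal entries by the diagonal ones.
  have hpair : ∀ (i j : Fin n) (c : ℝ), 0 ≤ Q i i + 2 * c * Q i j + c ^ 2 * Q j j := by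
    intro i j c
    have h1 : Dx (frame z i + c • frame z j) (Dx (frame z i + c • frame z j) (ext₁ S))
        ((z : Ambient n), t) = Q i i + 2 * c * Q i j + c ^ 2 * Q j j := by
      rw [Dx_add, Dx_smul, Dx_comm h.contDiffOn_two hp, Dx_add, Dx_smul,
        Dx_comm h.contDiffOn_two hp (frame z j) (frame z i + c • frame z j), Dx_add, Dx_smul,
        Dx_comm h.contDiffOn_two hp (frame z j) (frame z i)]
      simp only [hQ]
      ring
    rw [← h1]
    by_cases h0 : frame z i + c • frame z j = 0
    · rw [h0]
      have := Dx_smul (Dx (0 : Ambient n) (ext₁ S)) ((z : Ambient n), t) 0 0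
      rw [zero_smul, zero_mul] at this
      exact this.ge
    · refine (h.Dx_Dx_tangent_pos hz ?_ h0 ht).le
      rw [inner_add_right, inner_smul_right, hf.inner_base, hf.inner_base, mul_zero, add_zero]
  have hent : ∀ i j, hessMatrix (fun y => S y t) z i j ^ 2 ≤ (R + M) ^ 2 := by
    intro i j
    have h1 : Q i j = hessMatrix (fun y => S y t) z i j +
        S z t * (1 : Matrix (Fin n) (Fin n) ℝ) i j := h.hessExt_frame z ht hf i j
    have h2 := hpair i j 1
    have h3 := hpair i j (-1)
    have h4 := hQR i
    have h5 := hQR j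
    have h6 : |S z t * (1 : Matrix (Fin n) (Fin n) ℝ) i j| ≤ M := by
      rw [one_apply]
      split_ifs
      · simpa using hM
      · simpa using hM0
    rw [abs_le] at h6
    refine sq_le_sq' ?_ ?_ <;> linarith [h6.1, h6.2]
  rw [hessNorm]
  refine Real.sqrt_le_iff.2 ⟨by positivity, ?_⟩
  calc ∑ i, ∑ j, hessMatrix (fun y => S y t) z i j ^ 2 ≤ ∑ i : Fin n, ∑ j : Fin n, (R + M) ^ 2 :=
        Finset.sum_le_sum fun i _ => Finset.sum_le_sum fun j _ => hent i j
    _ = (n * (R + M)) ^ 2 := by simp; ring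

end IsNormalizedSolution

end GaussFlow

end

/-! ### The theorem -/

/-- Hessian bound for the normalized equation: the constant depends only on `n`, `α`, on positive
lower and upper bounds `m`, `M` of `S`, and on a bound `H` of the Hessian at the initial time. It
depends neither on the solution nor on `T ∈ (0, ∞]`; `T = ⊤` is the case of `𝕊^n × [0, ∞)`. -/
theorem lemma4p12 (n : ℕ) (hn : 1 ≤ n) (α : ℝ) (hα : 1 / (n : ℝ) < α) (hα1 : α ≤ 1)
    (m M H : ℝ) (hm : 0 < m) :
    ∃ C : ℝ, 0 < C ∧
      ∀ S : GaussFlow.USphere n → ℝ → ℝ, GaussFlow.IsNormalizedSolution α S →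
        (∀ z : GaussFlow.USphere n, GaussFlow.hessNorm (fun y => S y 0) z ≤ H) →
        ∀ T : EReal,
          (∀ (z : GaussFlow.USphere n) (τ : ℝ), 0 ≤ τ → (τ : EReal) < T →
            m ≤ S z τ ∧ S z τ ≤ M) →
          ∀ (z : GaussFlow.USphere n) (τ : ℝ), 0 ≤ τ → (τ : EReal) < T →
            GaussFlow.hessNorm (fun y => S y τ) z ≤ C := by
  have hα0 : 0 < α := lt_of_le_of_lt (by positivity) hα
  have hR : 0 < GaussFlow.radiiBound n α m M H := Real.exp_pos _
  -- `|M|` makes the constant positive for every real `M`. The given `τ` serves as final time, so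
  -- `T` does not enter.
  refine ⟨n * (GaussFlow.radiiBound n α m M H + |M|),
    mul_pos (by exact_mod_cast hn) (by positivity), fun S h hH T hS z τ hτ hτT => ?_⟩
  have hS' : ∀ z τ', 0 ≤ τ' → τ' ≤ τ → m ≤ S z τ' ∧ S z τ' ≤ M := fun z τ' h0 h1 =>
    hS z τ' h0 ((EReal.coe_le_coe_iff.2 h1).trans_lt hτT)
  refine h.hessNorm_le hτ z ?_ hR.le fun a ha hza =>
    h.Dx_Dx_le_radiiBound hn hα0 hm hH hτ hS' z ha hza
  have h1 := hS z τ hτ hτT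
  rw [abs_of_pos (hm.trans_le h1.1)]
  exact h1.2.trans (le_abs_self M)
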